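/- **Setting.** For each sample size $n$ let $X=X^{(n)}$ be a fixed real $n\times p$ design matrix ($p$ does not depend on $n$; an intercept, if present, is one of the columns). A model $M_\gamma$ is given by a set $\gamma$ of $d_\gamma$ columns; $X_\gamma$ is the submatrix of those columns, and under $M_\gamma$ the data satisfy $Y\sim N_n(X_\gamma\beta_\gamma,\sigma_\gamma^2 I_n)$. Let $\mathcal M$ be a finite set of models, all containing the columns of a reference model $M_0$ (e.g. the constant model), such that for every $M_\gamma\in\mathcal M$ the matrix $X_\gamma$ has full column rank for all large $n$; put $H_\gamma=X_\gamma(X_\gamma^TX_\gamma)^{-1}X_\gamma^T$. **J-PEP prior.** The baseline prior of $M_\gamma$ is $\pi^N_\gamma(\beta_\gamma,\sigma_\gamma^2)=c_\gamma/\sigma_\gamma^2$, with arbitrary constants $c_\gamma>0$. Let $f(y^*\mid\beta_\gamma,\sigma_\gamma^2,\delta)$ be the normal likelihood of $M_\gamma$ raised to the power $1/\delta$ and density-normalized in $y^*\in\mathbb R^n$, and let $m^N_\gamma(y^*)=\iint f(y^*\mid\beta_\gamma,\sigma_\gamma^2,\delta)\,\pi^N_\gamma(\beta_\gamma,\sigma_\gamma^2)\,d\beta_\gamma\,d\sigma_\gamma^2$.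 With power parameter $\delta=n$ and an imaginary sample of size $n^*=n$ with design $X^*=X$, the J-PEP prior is $$\pi_\gamma(\beta_\gamma,\sigma_\gamma^2)=\int\frac{f(y^*\mid\beta_\gamma,\sigma_\gamma^2,\delta)\,\pi^N_\gamma(\beta_\gamma,\sigma_\gamma^2)}{m^N_\gamma(y^*)}\,m^N_0(y^*)\,dy^* .$$ Let $m_\gamma(y)$ be the marginal likelihood of $y$ under $M_\gamma$ with the prior $\pi_\gamma$ and the ordinary normal likelihood, and let $BF_{jT}(y)=m_j(y)/m_T(y)$. **Claim.** Let the data be generated by the true model $M_T\in\mathcal M$: $Y\sim N_n(X_T\beta_T,\sigma^2I_n)$ with $\beta_T\in\mathbb R^{d_T}$ and $\sigma^2>0$ fixed. Assume that the limit of $X_T^T(I_n-H_0)X_T/n$ as $n\to\infty$ exists. Say that $M_j$ satisfies the limit condition if $$S_j=\lim_{n\to\infty}\frac{X_T^T(I_n-H_j)X_T}{n}$$ exists and is positive semi-definite and, unless $M_T$ is nested in $M_j$, $S_j\beta_T\neq0$. 1. If $M_j\in\mathcal M$, $M_j\ne M_T$, satisfies the limit condition, then $BF_{jT}\to0$ in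 probability (under the true model) as $n\to\infty$. 2. Hence, if every $M_j\in\mathcal M\setminus\{M_T\}$ satisfies the limit condition, J-PEP variable selection is consistent: for any fixed positive prior model probabilities on $\mathcal M$, the posterior probability of $M_T$ tends to $1$ in probability as $n\to\infty$. -/

import Mathlib

open MeasureTheory ProbabilityTheory Filter Topology
open scoped ENNReal NNReal Matrix

noncomputable section

namespace JPEP

/-- Density at `y` of the `n`-dimensional normal distribution with mean `μ` and covariance
matrix `v • 1`, as a product of one-dimensional normal densities (used for `v > 0`). -/
def normalDensity {n : ℕ} (μ : Fin n → ℝ) (v : ℝ) (y : Fin n → ℝ) : ℝ≥0∞ :=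
  ∏ i, gaussianPDF (μ i) v.toNNReal (y i)

/-- The normal likelihood raised to the power `1 / δ` and density-normalized. -/
def powerLikelihood {n : ℕ} (δ : ℝ) (μ : Fin n → ℝ) (v : ℝ) (y : Fin n → ℝ) : ℝ≥0∞ :=
  normalDensity μ v y ^ (1 / δ) / ∫⁻ z : Fin n → ℝ, normalDensity μ v z ^ (1 / δ)

/-- The independence Jeffreys baseline prior `π(β, σ²) = c / σ²` (improper, flat in `β`);
`v` stands for `σ²`. -/
def jeffreysPrior (c v : ℝ) : ℝ≥0∞ := ENNReal.ofReal (c / v)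

/-- Prior predictive density at `y` of the model with design matrix `A`, for the power likelihood
and the Jeffreys baseline prior with constant `c`. -/
def priorPredictive {n : ℕ} {ι : Type*} [Fintype ι] (δ c : ℝ) (A : Matrix (Fin n) ι ℝ)
    (y : Fin n → ℝ) : ℝ≥0∞ :=
  ∫⁻ v in Set.Ioi (0 : ℝ), ∫⁻ β : ι → ℝ, powerLikelihood δ (A *ᵥ β) v y * jeffreysPrior c v

/-- Density at `(β, σ²) = (β, v)` of the power-expected-posterior prior with Jeffreys baseline:
the baseline posterior of `(β, σ²)` given imaginary data `z` (power likelihood, imaginary design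
`A`, constant `c`), integrated against the prior predictive density of `z` under the reference
model (imaginary design `A₀`, constant `c₀`). -/
def pepPrior {m : ℕ} {ι ι₀ : Type*} [Fintype ι] [Fintype ι₀] (δ c c₀ : ℝ)
    (A : Matrix (Fin m) ι ℝ) (A₀ : Matrix (Fin m) ι₀ ℝ) (β : ι → ℝ) (v : ℝ) : ℝ≥0∞ :=
  ∫⁻ z : Fin m → ℝ,
    powerLikelihood δ (A *ᵥ β) v z * jeffreysPrior c v / priorPredictive δ c A z
      * priorPredictive δ c₀ A₀ z

/-- Marginal likelihood of the data `y` under the model with design matrix `A` and the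
power-expected-posterior prior built from the imaginary designs `A'` and `A₀'`. -/
def pepMarginal {n m : ℕ} {ι ι₀ : Type*} [Fintype ι] [Fintype ι₀] (δ c c₀ : ℝ)
    (A : Matrix (Fin n) ι ℝ) (A' : Matrix (Fin m) ι ℝ) (A₀' : Matrix (Fin m) ι₀ ℝ)
    (y : Fin n → ℝ) : ℝ≥0∞ :=
  ∫⁻ v in Set.Ioi (0 : ℝ), ∫⁻ β : ι → ℝ,
    normalDensity (A *ᵥ β) v y * pepPrior δ c c₀ A' A₀' β v

/-- A model is a set `γ` of columns of the full design matrix `X`; this is its design matrix. -/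
def design {n p : ℕ} (X : Matrix (Fin n) (Fin p) ℝ) (γ : Finset (Fin p)) :
    Matrix (Fin n) γ ℝ :=
  X.submatrix id Subtype.val

/-- The hat matrix `A (AᵀA)⁻¹ Aᵀ`. -/
def hatMatrix {n : ℕ} {ι : Type*} [Fintype ι] [DecidableEq ι] (A : Matrix (Fin n) ι ℝ) :
    Matrix (Fin n) (Fin n) ℝ :=
  A * (Aᵀ * A)⁻¹ * Aᵀ

/-- The matrix `X_Tᵀ (I - H_γ) X_T / n`. -/
def gapMatrix {n p : ℕ} (X : Matrix (Fin n) (Fin p) ℝ) (T γ : Finset (Fin p)) :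
    Matrix T T ℝ :=
  (n : ℝ)⁻¹ • ((design X T)ᵀ * (1 - hatMatrix (design X γ)) * design X T)

/-- J-PEP marginal likelihood of the model `γ` for the data `y`, with reference model `M₀`:
the imaginary sample has size `n* = n` and design `X* = X`, and the power parameter is `δ = n`.
`c` lists the (arbitrary) constants of the improper baseline priors. -/
def marginal {n p : ℕ} (c : Finset (Fin p) → ℝ) (X : Matrix (Fin n) (Fin p) ℝ)
    (M₀ γ : Finset (Fin p)) (y : Fin n → ℝ) : ℝ≥0∞ :=
  pepMarginal (n : ℝ) (c γ) (c M₀) (design X γ) (design X γ) (design X M₀) y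

/-- The J-PEP Bayes factor of the model `γ` against the model `T`. -/
def bayesFactor {n p : ℕ} (c : Finset (Fin p) → ℝ) (X : Matrix (Fin n) (Fin p) ℝ)
    (M₀ γ T : Finset (Fin p)) (y : Fin n → ℝ) : ℝ≥0∞ :=
  marginal c X M₀ γ y / marginal c X M₀ T y

/-- J-PEP posterior probability of the model `γ` in the model space `𝓜`, for prior model
probabilities proportional to `w`. -/
def posteriorProb {n p : ℕ} (c : Finset (Fin p) → ℝ) (w : Finset (Fin p) → ℝ)
    (X : Matrix (Fin n) (Fin p) ℝ) (M₀ : Finset (Fin p)) (𝓜 : Finset (Finset (Fin p)))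
    (γ : Finset (Fin p)) (y : Fin n → ℝ) : ℝ≥0∞ :=
  ENNReal.ofReal (w γ) * marginal c X M₀ γ y /
    ∑ γ' ∈ 𝓜, ENNReal.ofReal (w γ') * marginal c X M₀ γ' y

/-- The law of the data under the model `T` with coefficients `β` and error variance `v`:
independent normal responses with mean vector `X_T β` and common variance `v`. -/
def dataLaw {n p : ℕ} (X : Matrix (Fin n) (Fin p) ℝ) (T : Finset (Fin p)) (β : T → ℝ)
    (v : ℝ≥0) : Measure (Fin n → ℝ) :=
  Measure.pi fun i => gaussianReal ((design X T *ᵥ β) i) v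

/-- Convergence in probability to the constant `a`, as `n → ∞`, of statistics `Z n` of data of
size `n` with law `P n`. -/
def TendstoInProb (P : (n : ℕ) → Measure (Fin n → ℝ)) (Z : (n : ℕ) → (Fin n → ℝ) → ℝ≥0∞)
    (a : ℝ≥0∞) : Prop :=
  ∀ U ∈ 𝓝 a, Tendsto (fun n => P n {y | Z n y ∉ U}) atTop (𝓝 0)

/-- The condition on a model `γ` competing with the true model `T` with coefficients `β`:
`X_Tᵀ (I - H_γ) X_T / n` converges to a positive semi-definite matrix, which, unless `T` is nested
in `γ`, does not annihilate `β`. -/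
def LimitCondition {p : ℕ} (X : (n : ℕ) → Matrix (Fin n) (Fin p) ℝ) (T : Finset (Fin p))
    (β : T → ℝ) (γ : Finset (Fin p)) : Prop :=
  ∃ S : Matrix T T ℝ, Tendsto (fun n => gapMatrix (X n) T γ) atTop (𝓝 S) ∧
    S.PosSemidef ∧ (¬ T ⊆ γ → S *ᵥ β ≠ 0)

end JPEP

end

open MeasureTheory ProbabilityTheory Filter Topology
open scoped ENNReal NNReal Matrix

noncomputable section
-- Raising a normal density to the power 1/δ and renormalizing multiplies its variance by δ.
-- Integrating out β and σ² then gives a prior predictive density proportional to RSS^(-s), where s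
-- is half the residual degrees of freedom. So the prior of a model with design A and reference
-- design B is a constant over σ² times the mean of RSS_A^(s_A) RSS_B^(-s_B) under N(Aβ, nσ² I). Put
-- h = s_B - s_A = (d_A - d_B)/2.
--
-- The marginal likelihood is not computed but bounded on both sides. Above: RSS_A ≤ RSS_B reduces
-- that mean to a negative chi-square moment free of β, so the marginal is at most of order n^(-h)
-- RSS_A(y)^(-s_B) (`pepMarginal_le`). Below: by Markov's inequality RSS_A and RSS_B - RSS_A have
-- their expected sizes with probability at least 1/2 (`le_lintegral_predictiveRatio`), and the loss
-- only replaces RSS_A(y) by RSS_A(y) + (512/n) RSS_B(y) (`le_pepMarginal`). The Gamma factors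
-- contribute powers of n, the constant c of the model itself cancels inside its prior, and the
-- reference constants cancel in the quotient, which leaves (`exists_bayesFactor_le`) BF_jT ≤ K
-- n^((d_T - d_j)/2) (RSS_T/RSS_j)^((n - d_0)/2) exp(256 RSS_0/RSS_T).
--
-- The limit assumed for the reference model keeps RSS_0/RSS_T bounded in probability. If T is
-- nested in j, then RSS_T - RSS_j is bounded in probability while both terms are at least of order
-- n, so the middle factor is bounded and the power of n tends to 0. Otherwise RSS_j exceeds ‖ε‖² ≥
-- RSS_T by a multiple of n, where ε is the error vector, and the middle factor decays
-- exponentially. Every probabilistic estimate is Markov's inequality for a statistic of bounded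
-- mean (`tendstoInProb_zero_of_lintegral_le`). The posterior probability is a continuous function
-- of the Bayes factors.
namespace JPEP

/-! ### Projections, hat matrices and residual sums of squares. -/

section LinearAlgebra

variable {n : ℕ} {ι κ : Type*} [Fintype ι] [DecidableEq ι] [Fintype κ] [DecidableEq κ]

/-- Squared Euclidean norm. -/
def sqNorm {α : Type*} [Fintype α] (y : α → ℝ) : ℝ := y ⬝ᵥ y

/-- Residual sum of squares of `y` for the regression with design matrix `A`. -/
def rss (A : Matrix (Fin n) ι ℝ) (y : Fin n → ℝ) : ℝ := y ⬝ᵥ ((1 - hatMatrix A) *ᵥ y)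

theorem sqNorm_nonneg {α : Type*} [Fintype α] (y : α → ℝ) : 0 ≤ sqNorm y :=
  Finset.sum_nonneg fun _ _ => mul_self_nonneg _

theorem sqNorm_eq_sum {α : Type*} [Fintype α] (y : α → ℝ) : sqNorm y = ∑ i, y i ^ 2 := by
  simp [sqNorm, dotProduct, sq]

theorem continuous_sqNorm {α : Type*} [Fintype α] : Continuous (sqNorm : (α → ℝ) → ℝ) := by
  unfold sqNorm dotProduct; fun_prop

theorem sqNorm_add {α : Type*} [Fintype α] (x y : α → ℝ) :
    sqNorm (x + y) = sqNorm x + 2 * (x ⬝ᵥ y) + sqNorm y := by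
  simp only [sqNorm, add_dotProduct, dotProduct_add, dotProduct_comm y x]; ring

theorem sqNorm_sub {α : Type*} [Fintype α] (x y : α → ℝ) :
    sqNorm (x - y) = sqNorm x - 2 * (x ⬝ᵥ y) + sqNorm y := by
  simp only [sqNorm, sub_dotProduct, dotProduct_sub, dotProduct_comm y x]; ring

theorem sqNorm_smul {α : Type*} [Fintype α] (a : ℝ) (x : α → ℝ) :
    sqNorm (a • x) = a ^ 2 * sqNorm x := by
  simp only [sqNorm, smul_dotProduct, dotProduct_smul, smul_eq_mul]; ring

theorem sqNorm_add_le {α : Type*} [Fintype α] (x y : α → ℝ) :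
    sqNorm (x + y) ≤ 2 * sqNorm x + 2 * sqNorm y := by
  have := sqNorm_nonneg (x - y)
  rw [sqNorm_sub] at this
  rw [sqNorm_add]; linarith

theorem sqNorm_neg {α : Type*} [Fintype α] (x : α → ℝ) : sqNorm (-x) = sqNorm x := by
  simp [sqNorm]

/-- Symmetric idempotent real matrices, that is, orthogonal projections. -/
structure IsProj (P : Matrix (Fin n) (Fin n) ℝ) : Prop where
  symm : Pᵀ = P
  idem : P * P = P

namespace IsProj

variable {P Q : Matrix (Fin n) (Fin n) ℝ}

theorem dotProduct_mulVec (hP : IsProj P) (x y : Fin n → ℝ) :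
    (P *ᵥ x) ⬝ᵥ (P *ᵥ y) = x ⬝ᵥ (P *ᵥ y) := by
  rw [← Matrix.dotProduct_transpose_mulVec, Matrix.mulVec_mulVec, hP.symm, hP.idem,
    ← Matrix.dotProduct_transpose_mulVec, hP.symm]

theorem sqNorm_mulVec (hP : IsProj P) (y : Fin n → ℝ) : sqNorm (P *ᵥ y) = y ⬝ᵥ (P *ᵥ y) :=
  hP.dotProduct_mulVec y y

theorem quadratic_nonneg (hP : IsProj P) (y : Fin n → ℝ) : 0 ≤ y ⬝ᵥ (P *ᵥ y) := by
  rw [← hP.sqNorm_mulVec]; exact sqNorm_nonneg _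

theorem compl (hP : IsProj P) : IsProj (1 - P) where
  symm := by rw [Matrix.transpose_sub, hP.symm, Matrix.transpose_one]
  idem := by rw [sub_mul, mul_sub, mul_sub, hP.idem]; simp

theorem sub (hP : IsProj P) (hQ : IsProj Q) (h : P * Q = Q) : IsProj (P - Q) where
  symm := by rw [Matrix.transpose_sub, hP.symm, hQ.symm]
  idem := by
    have h' : Q * P = Q := by
      rw [← hP.symm, ← hQ.symm, ← Matrix.transpose_mul, h]
    rw [sub_mul, mul_sub, mul_sub, hP.idem, hQ.idem, h, h']; simp

theorem quadratic_add_compl (P : Matrix (Fin n) (Fin n) ℝ) (y : Fin n → ℝ) :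
    y ⬝ᵥ (P *ᵥ y) + y ⬝ᵥ ((1 - P) *ᵥ y) = sqNorm y := by
  rw [← dotProduct_add, ← Matrix.add_mulVec]; simp [sqNorm]

theorem sqNorm_mulVec_le (hP : IsProj P) (y : Fin n → ℝ) : sqNorm (P *ᵥ y) ≤ sqNorm y := by
  rw [hP.sqNorm_mulVec, ← quadratic_add_compl P y]
  linarith [hP.compl.quadratic_nonneg y]

end IsProj

theorem mulVec_injective_of_col {α : Type*} [Fintype α] {A : Matrix (Fin n) α ℝ}
    (hA : LinearIndependent ℝ A.col) :
    Function.Injective A.mulVec :=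
  Matrix.mulVec_injective_iff.2 hA

theorem isUnit_det_gram {A : Matrix (Fin n) ι ℝ} (hA : LinearIndependent ℝ A.col) :
    IsUnit (Aᵀ * A).det := by
  rw [← Matrix.isUnit_iff_isUnit_det]
  have := Matrix.PosDef.conjTranspose_mul_self A (mulVec_injective_of_col hA)
  simpa using this.isUnit

theorem hatMatrix_mul_self {A : Matrix (Fin n) ι ℝ} (hA : LinearIndependent ℝ A.col) :
    hatMatrix A * A = A := by
  unfold hatMatrix
  rw [Matrix.mul_assoc, Matrix.mul_assoc, Matrix.nonsing_inv_mul _ (isUnit_det_gram hA),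
    Matrix.mul_one]

theorem isProj_hatMatrix {A : Matrix (Fin n) ι ℝ} (hA : LinearIndependent ℝ A.col) :
    IsProj (hatMatrix A) where
  symm := by
    unfold hatMatrix
    rw [Matrix.transpose_mul, Matrix.transpose_mul, Matrix.transpose_nonsing_inv,
      Matrix.transpose_mul, Matrix.transpose_transpose, Matrix.mul_assoc]
  idem := by
    conv_lhs => enter [2]; unfold hatMatrix
    rw [Matrix.mul_assoc A, ← Matrix.mul_assoc, hatMatrix_mul_self hA, ← Matrix.mul_assoc]
    rfl

theorem trace_hatMatrix {A : Matrix (Fin n) ι ℝ} (hA : LinearIndependent ℝ A.col) :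
    (hatMatrix A).trace = Fintype.card ι := by
  unfold hatMatrix
  rw [Matrix.trace_mul_comm, ← Matrix.mul_assoc, Matrix.mul_nonsing_inv _ (isUnit_det_gram hA),
    Matrix.trace_one]

theorem hatMatrix_mulVec (A : Matrix (Fin n) ι ℝ) (y : Fin n → ℝ) :
    ∃ b, hatMatrix A *ᵥ y = A *ᵥ b :=
  ⟨((Aᵀ * A)⁻¹ * Aᵀ) *ᵥ y, by rw [Matrix.mulVec_mulVec, hatMatrix, Matrix.mul_assoc]⟩

theorem rss_eq_sqNorm {A : Matrix (Fin n) ι ℝ} (hA : LinearIndependent ℝ A.col)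
    (y : Fin n → ℝ) : rss A y = sqNorm ((1 - hatMatrix A) *ᵥ y) :=
  ((isProj_hatMatrix hA).compl.sqNorm_mulVec y).symm

theorem rss_nonneg {A : Matrix (Fin n) ι ℝ} (hA : LinearIndependent ℝ A.col)
    (y : Fin n → ℝ) : 0 ≤ rss A y :=
  (isProj_hatMatrix hA).compl.quadratic_nonneg y

theorem compl_hatMatrix_mulVec {A : Matrix (Fin n) ι ℝ} (hA : LinearIndependent ℝ A.col)
    (b : ι → ℝ) : (1 - hatMatrix A) *ᵥ (A *ᵥ b) = 0 := by
  rw [Matrix.mulVec_mulVec, Matrix.sub_mul, hatMatrix_mul_self hA, Matrix.one_mul, sub_self,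
    Matrix.zero_mulVec]

theorem rss_add_mulVec {A : Matrix (Fin n) ι ℝ} (hA : LinearIndependent ℝ A.col)
    (y : Fin n → ℝ) (b : ι → ℝ) : rss A (y + A *ᵥ b) = rss A y := by
  rw [rss_eq_sqNorm hA, rss_eq_sqNorm hA, Matrix.mulVec_add, compl_hatMatrix_mulVec hA, add_zero]

theorem rss_mulVec {A : Matrix (Fin n) ι ℝ} (hA : LinearIndependent ℝ A.col)
    (b : ι → ℝ) : rss A (A *ᵥ b) = 0 := by
  rw [rss_eq_sqNorm hA, compl_hatMatrix_mulVec hA]; simp [sqNorm]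

/-- Pythagoras: the residual of y is orthogonal to the column space of A. -/
theorem sqNorm_sub_mulVec {A : Matrix (Fin n) ι ℝ} (hA : LinearIndependent ℝ A.col)
    (y : Fin n → ℝ) (b : ι → ℝ) :
    sqNorm (y - A *ᵥ b) = rss A y + sqNorm (hatMatrix A *ᵥ y - A *ᵥ b) := by
  have h := IsProj.quadratic_add_compl (hatMatrix A) (y - A *ᵥ b)
  have h2 : hatMatrix A *ᵥ (y - A *ᵥ b) = hatMatrix A *ᵥ y - A *ᵥ b := by
    rw [Matrix.mulVec_sub, Matrix.mulVec_mulVec, hatMatrix_mul_self hA]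
  rw [← (isProj_hatMatrix hA).sqNorm_mulVec, h2] at h
  have h3 : rss A (y - A *ᵥ b) = rss A y := by
    rw [sub_eq_add_neg, ← Matrix.mulVec_neg, rss_add_mulVec hA]
  rw [← h3, ← h, rss]; ring

theorem rss_le_sqNorm_sub {A : Matrix (Fin n) ι ℝ} (hA : LinearIndependent ℝ A.col)
    (y : Fin n → ℝ) (b : ι → ℝ) : rss A y ≤ sqNorm (y - A *ᵥ b) := by
  rw [sqNorm_sub_mulVec hA]; linarith [sqNorm_nonneg (hatMatrix A *ᵥ y - A *ᵥ b)]

theorem continuous_rss (A : Matrix (Fin n) ι ℝ) : Continuous (rss A) := by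
  unfold rss dotProduct Matrix.mulVec dotProduct; fun_prop

section Nested

variable {A : Matrix (Fin n) ι ℝ} {B : Matrix (Fin n) κ ℝ}

/-- The hypothesis `hatMatrix A * B = B` expresses throughout that the column space of B lies in
that of A. -/
theorem hatMatrix_mul_hatMatrix (h : hatMatrix A * B = B) :
    hatMatrix A * hatMatrix B = hatMatrix B := by
  conv_lhs => rw [hatMatrix.eq_def B]
  rw [← Matrix.mul_assoc, ← Matrix.mul_assoc, h]; rfl

theorem isProj_hatMatrix_sub (hA : LinearIndependent ℝ A.col) (hB : LinearIndependent ℝ B.col)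
    (h : hatMatrix A * B = B) : IsProj (hatMatrix A - hatMatrix B) :=
  (isProj_hatMatrix hA).sub (isProj_hatMatrix hB) (hatMatrix_mul_hatMatrix h)

theorem rss_sub_rss (y : Fin n → ℝ) :
    rss B y - rss A y = y ⬝ᵥ ((hatMatrix A - hatMatrix B) *ᵥ y) := by
  rw [rss, rss, ← dotProduct_sub, ← Matrix.sub_mulVec]; congr 2; abel

/-- For nested column spaces (1 - H_B) H_A = H_A - H_B, which is again a projection. -/
theorem rss_hatMatrix_mulVec (hA : LinearIndependent ℝ A.col) (hB : LinearIndependent ℝ B.col)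
    (h : hatMatrix A * B = B) (y : Fin n → ℝ) :
    rss B (hatMatrix A *ᵥ y) = rss B y - rss A y := by
  have hcomm : hatMatrix B * hatMatrix A = hatMatrix B := by
    rw [← (isProj_hatMatrix hA).symm, ← (isProj_hatMatrix hB).symm, ← Matrix.transpose_mul,
      hatMatrix_mul_hatMatrix h]
  rw [rss_eq_sqNorm hB, Matrix.mulVec_mulVec, Matrix.sub_mul, hcomm, Matrix.one_mul,
    (isProj_hatMatrix_sub hA hB h).sqNorm_mulVec, rss_sub_rss]

theorem rss_le_rss (hA : LinearIndependent ℝ A.col) (hB : LinearIndependent ℝ B.col)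
    (h : hatMatrix A * B = B) (y : Fin n → ℝ) : rss A y ≤ rss B y := by
  have := (isProj_hatMatrix_sub hA hB h).quadratic_nonneg y
  rw [← rss_sub_rss] at this; linarith

end Nested

theorem design_mul_selection {p : ℕ} (X : Matrix (Fin n) (Fin p) ℝ) {γ δ : Finset (Fin p)}
    (h : γ ⊆ δ) :
    design X γ = design X δ * Matrix.of fun (i : δ) (k : γ) => if i.1 = k.1 then (1 : ℝ) else 0 := by
  ext i k
  rw [Matrix.mul_apply, Finset.sum_eq_single ⟨k.1, h k.2⟩]
  · simp [design]
  · intro b _ hb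
    have : b.1 ≠ k.1 := fun e => hb (Subtype.ext e)
    simp [this]
  · simp

theorem hatMatrix_mul_design {p : ℕ} {X : Matrix (Fin n) (Fin p) ℝ} {γ δ : Finset (Fin p)}
    (h : γ ⊆ δ) (hδ : LinearIndependent ℝ (design X δ).col) :
    hatMatrix (design X δ) * design X γ = design X γ := by
  conv_lhs => rw [design_mul_selection X h]
  rw [← Matrix.mul_assoc, hatMatrix_mul_self hδ, ← design_mul_selection X h]

theorem linearIndependent_design_of_subset {p : ℕ} {X : Matrix (Fin n) (Fin p) ℝ}
    {γ δ : Finset (Fin p)} (h : γ ⊆ δ) (hδ : LinearIndependent ℝ (design X δ).col) :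
    LinearIndependent ℝ (design X γ).col :=
  hδ.comp (fun k : γ => (⟨k.1, h k.2⟩ : δ)) fun a b hab => by
    have := congrArg Subtype.val hab
    exact Subtype.ext this

end LinearAlgebra

/-! ### Gaussian integrals over coefficients and Gamma integrals over the variance. -/

section Integrals

theorem lintegral_exp_neg_mul_sqNorm {α : Type*} [Fintype α] {t : ℝ} (ht : 0 < t) :
    ∫⁻ z : α → ℝ, ENNReal.ofReal (Real.exp (-(t * sqNorm z)))
      = ENNReal.ofReal ((Real.pi / t) ^ ((Fintype.card α : ℝ) / 2)) := by
  have h : ∀ z : α → ℝ, Real.exp (-(t * sqNorm z)) = ∏ i, Real.exp (-t * z i ^ 2) := by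
    intro z
    rw [← Real.exp_sum, sqNorm_eq_sum, Finset.mul_sum, ← Finset.sum_neg_distrib]
    simp
  simp_rw [h]
  rw [← ofReal_integral_eq_lintegral_ofReal]
  · rw [integral_fintype_prod_volume_eq_pow (fun x : ℝ => Real.exp (-t * x ^ 2)),
      integral_gaussian, Real.sqrt_eq_rpow, ← Real.rpow_natCast,
      ← Real.rpow_mul (by positivity)]
    congr 2; ring
  · exact Integrable.fintype_prod (f := fun _ x => Real.exp (-t * x ^ 2))
      fun _ => integrable_exp_neg_mul_sq ht
  · exact Eventually.of_forall fun z => Finset.prod_nonneg fun _ _ => (Real.exp_pos _).le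

theorem lintegral_comp_smul_of_pos {α : Type*} [Fintype α] {r : ℝ} (hr : 0 < r)
    {f : (α → ℝ) → ℝ≥0∞} (hf : Measurable f) :
    ∫⁻ b, f (r • b) = ENNReal.ofReal (r ^ (-(Fintype.card α : ℝ))) * ∫⁻ b, f b := by
  rw [← lintegral_map hf (measurable_const_smul r), Measure.map_addHaar_smul _ hr.ne',
    lintegral_smul_measure, smul_eq_mul, Module.finrank_fintype_fun_eq_card,
    abs_of_pos (by positivity), Real.rpow_neg hr.le, Real.rpow_natCast]

/-- The integral of `exp (-‖A b‖²)` over the coefficient vectors `b`. -/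
def coefMass {n : ℕ} {ι : Type*} [Fintype ι] (A : Matrix (Fin n) ι ℝ) : ℝ :=
  (∫⁻ b : ι → ℝ, ENNReal.ofReal (Real.exp (-sqNorm (A *ᵥ b)))).toReal

theorem continuous_sqNorm_mulVec {n : ℕ} {ι : Type*} [Fintype ι] (A : Matrix (Fin n) ι ℝ) :
    Continuous fun b : ι → ℝ => sqNorm (A *ᵥ b) :=
  continuous_sqNorm.comp (Continuous.matrix_mulVec continuous_const continuous_id)

/-- An injective linear map in finite dimension is bounded below; this makes the Gaussian integral
over coefficients finite. -/
theorem exists_mul_sqNorm_le {n : ℕ} {ι : Type*} [Fintype ι] {A : Matrix (Fin n) ι ℝ}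
    (hA : LinearIndependent ℝ A.col) :
    ∃ c > 0, ∀ b : ι → ℝ, c * sqNorm b ≤ sqNorm (A *ᵥ b) := by
  obtain ⟨K, hK, hAK⟩ := LinearMap.exists_antilipschitzWith A.mulVecLin
    (LinearMap.ker_eq_bot.2 (mulVec_injective_of_col hA))
  have hcoord : ∀ {m : ℕ} (y : Fin m → ℝ), ‖y‖ ^ 2 ≤ sqNorm y := by
    intro m y
    have h2 : ‖y‖ ≤ Real.sqrt (sqNorm y) := by
      refine (pi_norm_le_iff_of_nonneg (Real.sqrt_nonneg _)).2 fun i => ?_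
      rw [Real.norm_eq_abs]
      refine Real.abs_le_sqrt ?_
      rw [sqNorm_eq_sum]
      exact Finset.single_le_sum (f := fun i => y i ^ 2) (fun _ _ => sq_nonneg _)
        (Finset.mem_univ i)
    calc ‖y‖ ^ 2 ≤ Real.sqrt (sqNorm y) ^ 2 := by gcongr
      _ = _ := Real.sq_sqrt (sqNorm_nonneg y)
  have hK' : (0 : ℝ) < K := by exact_mod_cast hK
  -- The dimension compares the supremum norm with the Euclidean one; the `+ 1` keeps the constant
  -- meaningful when there are no columns.
  refine ⟨((Fintype.card ι + 1) * K ^ 2)⁻¹, by positivity, fun b => ?_⟩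
  have h1 : sqNorm b ≤ Fintype.card ι * ‖b‖ ^ 2 := by
    rw [sqNorm_eq_sum]
    calc ∑ i, b i ^ 2 ≤ ∑ _i : ι, ‖b‖ ^ 2 := by
          refine Finset.sum_le_sum fun i _ => ?_
          rw [← sq_abs, ← Real.norm_eq_abs]
          gcongr
          exact norm_le_pi_norm b i
      _ = _ := by simp
  have h2 : ‖b‖ ≤ K * ‖A *ᵥ b‖ := by
    simpa using hAK.le_mul_norm_sub (x := b) (y := 0)
  have h3 : ‖b‖ ^ 2 ≤ K ^ 2 * sqNorm (A *ᵥ b) := by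
    calc ‖b‖ ^ 2 ≤ (K * ‖A *ᵥ b‖) ^ 2 := by gcongr
      _ = K ^ 2 * ‖A *ᵥ b‖ ^ 2 := by ring
      _ ≤ _ := by gcongr; exact hcoord _
  rw [inv_mul_le_iff₀ (by positivity)]
  calc sqNorm b ≤ (Fintype.card ι + 1) * ‖b‖ ^ 2 := by nlinarith [sq_nonneg ‖b‖]
    _ ≤ (Fintype.card ι + 1) * (K ^ 2 * sqNorm (A *ᵥ b)) := by gcongr
    _ = _ := by ring

section

variable {n : ℕ} {ι : Type*} [Fintype ι] {A : Matrix (Fin n) ι ℝ}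

theorem lintegral_exp_neg_sqNorm_mulVec (hA : LinearIndependent ℝ A.col) :
    ∫⁻ b : ι → ℝ, ENNReal.ofReal (Real.exp (-sqNorm (A *ᵥ b))) = ENNReal.ofReal (coefMass A) := by
  obtain ⟨c, hc, h⟩ := exists_mul_sqNorm_le hA
  rw [coefMass, ENNReal.ofReal_toReal]
  refine ne_top_of_le_ne_top ?_ (lintegral_mono fun b => ENNReal.ofReal_le_ofReal
    (Real.exp_le_exp.2 (neg_le_neg (h b))))
  rw [lintegral_exp_neg_mul_sqNorm hc]
  exact ENNReal.ofReal_ne_top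

theorem coefMass_pos (hA : LinearIndependent ℝ A.col) : 0 < coefMass A := by
  rw [← ENNReal.ofReal_pos, ← lintegral_exp_neg_sqNorm_mulVec hA, lintegral_pos_iff_support]
  · have : Function.support (fun b : ι → ℝ => ENNReal.ofReal (Real.exp (-sqNorm (A *ᵥ b))))
        = Set.univ :=
      Set.eq_univ_of_forall fun b => (ENNReal.ofReal_pos.2 (Real.exp_pos _)).ne'
    rw [this]
    exact isOpen_univ.measure_pos _ Set.univ_nonempty
  · exact (continuous_sqNorm_mulVec A).measurable.neg.exp.ennreal_ofReal

variable [DecidableEq ι]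

/-- Pythagoras splits off the residual; translating to the fitted coefficients and rescaling by √a
reduces the rest to `coefMass A`. That constant is left unevaluated because it cancels between prior
and likelihood. -/
theorem lintegral_exp_neg_mul_sqNorm_sub (hA : LinearIndependent ℝ A.col) {a : ℝ} (ha : 0 < a)
    (z : Fin n → ℝ) :
    ∫⁻ b : ι → ℝ, ENNReal.ofReal (Real.exp (-(a * sqNorm (z - A *ᵥ b))))
      = ENNReal.ofReal (Real.exp (-(a * rss A z)) * a ^ (-(Fintype.card ι : ℝ) / 2)
          * coefMass A) := by
  obtain ⟨b₀, hb₀⟩ := hatMatrix_mulVec A z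
  have h : ∀ b, ENNReal.ofReal (Real.exp (-(a * sqNorm (z - A *ᵥ b))))
      = ENNReal.ofReal (Real.exp (-(a * rss A z))) *
        ENNReal.ofReal (Real.exp (-sqNorm (A *ᵥ (Real.sqrt a • (b₀ - b))))) := by
    intro b
    rw [← ENNReal.ofReal_mul (Real.exp_pos _).le, ← Real.exp_add, Matrix.mulVec_smul, sqNorm_smul,
      Real.sq_sqrt ha.le, sqNorm_sub_mulVec hA, hb₀, ← Matrix.mulVec_sub]
    congr 2; ring
  have hm : Measurable fun b : ι → ℝ => ENNReal.ofReal (Real.exp (-sqNorm (A *ᵥ b))) :=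
    (continuous_sqNorm_mulVec A).measurable.neg.exp.ennreal_ofReal
  simp_rw [h]
  rw [lintegral_const_mul' _ _ ENNReal.ofReal_ne_top,
    lintegral_sub_left_eq_self
      (fun b => ENNReal.ofReal (Real.exp (-sqNorm (A *ᵥ (Real.sqrt a • b))))),
    lintegral_comp_smul_of_pos (Real.sqrt_pos.2 ha) hm, lintegral_exp_neg_sqNorm_mulVec hA,
    mul_assoc, ENNReal.ofReal_mul (Real.exp_pos _).le, ENNReal.ofReal_mul (by positivity),
    Real.sqrt_eq_rpow, ← Real.rpow_mul ha.le]
  congr 4; ring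

end

theorem lintegral_rpow_mul_exp_neg {s R : ℝ} (hs : 0 < s) (hR : 0 ≤ R) :
    ∫⁻ u in Set.Ioi (0 : ℝ), ENNReal.ofReal (u ^ (s - 1) * Real.exp (-(R * u)))
      = ENNReal.ofReal (Real.Gamma s) * ENNReal.ofReal R ^ (-s) := by
  have hpos : ∀ᵐ u ∂volume.restrict (Set.Ioi (0 : ℝ)), 0 ≤ u ^ (s - 1) * Real.exp (-(R * u)) :=
    (ae_restrict_mem measurableSet_Ioi).mono fun u hu =>
      mul_nonneg (Real.rpow_nonneg (le_of_lt hu) _) (Real.exp_pos _).le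
  rcases hR.eq_or_lt with rfl | hR
  -- At R = 0 both sides are infinite: a power of u is not integrable on the half-line.
  · rw [ENNReal.ofReal_zero, ENNReal.zero_rpow_of_neg (by linarith),
      ENNReal.mul_top (ENNReal.ofReal_pos.2 (Real.Gamma_pos_of_pos hs)).ne']
    by_contra hne
    apply not_integrableOn_Ioi_rpow (s - 1)
    refine ⟨(measurable_id.pow_const (s - 1)).aestronglyMeasurable, ?_⟩
    rw [hasFiniteIntegral_iff_ofReal]
    · simpa using lt_top_iff_ne_top.2 hne
    · filter_upwards [hpos] with u hu
      simpa using hu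
  · have hval := Real.integral_rpow_mul_exp_neg_mul_Ioi hs hR
    rw [← ofReal_integral_eq_lintegral_ofReal _ hpos, hval, mul_comm,
      ENNReal.ofReal_mul (Real.Gamma_pos_of_pos hs).le, ENNReal.ofReal_rpow_of_pos hR,
      one_div, Real.inv_rpow hR.le, Real.rpow_neg hR.le]
    by_contra hne
    rw [integral_undef hne] at hval
    have : 0 < (1 / R) ^ s * Real.Gamma s := mul_pos (by positivity) (Real.Gamma_pos_of_pos hs)
    linarith

/-- Substitute v = 1/(κu). The measure dv/v is scale invariant, so κ drops out; this is why the
power parameter disappears from the prior predictive density. -/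
theorem lintegral_inv_mul_rpow_mul_exp {s R κ : ℝ} (hs : 0 < s) (hR : 0 ≤ R) (hκ : 0 < κ) :
    ∫⁻ v in Set.Ioi (0 : ℝ),
        ENNReal.ofReal (v⁻¹ * (κ * v) ^ (-s) * Real.exp (-(R / (κ * v))))
      = ENNReal.ofReal (Real.Gamma s) * ENNReal.ofReal R ^ (-s) := by
  have himg : (fun u : ℝ => (κ * u)⁻¹) '' Set.Ioi 0 = Set.Ioi 0 := by
    ext x
    constructor
    · rintro ⟨u, hu, rfl⟩
      exact inv_pos.2 (mul_pos hκ hu)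
    · intro hx
      have hx' : (0 : ℝ) < x := hx
      refine ⟨(κ * x)⁻¹, inv_pos.2 (mul_pos hκ hx), ?_⟩
      simp only
      field_simp
  have hder : ∀ u ∈ Set.Ioi (0 : ℝ),
      HasDerivWithinAt (fun u : ℝ => (κ * u)⁻¹) (-κ / (κ * u) ^ 2) (Set.Ioi 0) u := by
    intro u hu
    have h1 : HasDerivAt (fun u : ℝ => κ * u) κ u := by
      simpa using (hasDerivAt_id u).const_mul κ
    exact (h1.inv (mul_pos hκ hu).ne').hasDerivWithinAt
  have hinj : Set.InjOn (fun u : ℝ => (κ * u)⁻¹) (Set.Ioi 0) := by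
    intro a _ b _ hab
    exact mul_left_cancel₀ hκ.ne' (inv_injective hab)
  rw [← lintegral_rpow_mul_exp_neg hs hR]
  conv_lhs => rw [← himg]
  rw [lintegral_image_eq_lintegral_abs_deriv_mul measurableSet_Ioi hder hinj]
  refine setLIntegral_congr_fun measurableSet_Ioi fun u hu => ?_
  have hu' : (0 : ℝ) < u := hu
  rw [← ENNReal.ofReal_mul (abs_nonneg _)]
  congr 1
  have e1 : κ * (κ * u)⁻¹ = u⁻¹ := by field_simp
  rw [e1, inv_inv, Real.inv_rpow hu'.le, Real.rpow_neg hu'.le, inv_inv, neg_div, abs_neg,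
    abs_of_pos (by positivity), Real.rpow_sub_one hu'.ne', div_inv_eq_mul]
  field_simp

end Integrals

/-! ### The normal density, its power version and its quadratic moments. -/

section NormalDensity

variable {n : ℕ}

theorem normalDensity_eq (μ : Fin n → ℝ) {v : ℝ} (hv : 0 < v) (y : Fin n → ℝ) :
    normalDensity μ v y = ENNReal.ofReal
      ((2 * Real.pi * v) ^ (-(n : ℝ) / 2) * Real.exp (-(1 / (2 * v) * sqNorm (y - μ)))) := by
  have hc : (v.toNNReal : ℝ) = v := Real.coe_toNNReal v hv.le
  simp only [normalDensity, gaussianPDF_def, gaussianPDFReal_def, hc]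
  rw [← ENNReal.ofReal_prod_of_nonneg fun i _ => by positivity, Finset.prod_mul_distrib,
    Finset.prod_const, Finset.card_univ, Fintype.card_fin, ← Real.exp_sum, sqNorm_eq_sum]
  congr 2
  · rw [Real.sqrt_eq_rpow, ← Real.rpow_neg (by positivity), ← Real.rpow_natCast,
      ← Real.rpow_mul (by positivity)]
    congr 1; ring
  · rw [Finset.mul_sum, ← Finset.sum_neg_distrib]
    congr 1
    refine Finset.sum_congr rfl fun i _ => ?_
    simp only [Pi.sub_apply]; ring

theorem measurable_normalDensity (μ : Fin n → ℝ) (v : ℝ) : Measurable (normalDensity μ v) := by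
  unfold normalDensity
  exact Finset.measurable_prod _ fun i _ =>
    (measurable_gaussianPDF _ _).comp (measurable_pi_apply i)

theorem normalDensity_ne_top (μ : Fin n → ℝ) {v : ℝ} (hv : 0 < v) (y : Fin n → ℝ) :
    normalDensity μ v y ≠ ∞ := by
  rw [normalDensity_eq μ hv]; exact ENNReal.ofReal_ne_top

theorem lintegral_exp_neg_mul_sqNorm_sub_const {t : ℝ} (ht : 0 < t) (μ : Fin n → ℝ) :
    ∫⁻ z : Fin n → ℝ, ENNReal.ofReal (Real.exp (-(t * sqNorm (z - μ))))
      = ENNReal.ofReal ((Real.pi / t) ^ ((n : ℝ) / 2)) := by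
  rw [lintegral_sub_right_eq_self
    (fun z : Fin n → ℝ => ENNReal.ofReal (Real.exp (-(t * sqNorm z)))),
    lintegral_exp_neg_mul_sqNorm ht, Fintype.card_fin]

theorem lintegral_normalDensity (μ : Fin n → ℝ) {v : ℝ} (hv : 0 < v) :
    ∫⁻ y, normalDensity μ v y = 1 := by
  have hp : (0 : ℝ) < 2 * Real.pi * v := by positivity
  simp_rw [normalDensity_eq μ hv,
    fun y : Fin n → ℝ => ENNReal.ofReal_mul
      (q := Real.exp (-(1 / (2 * v) * sqNorm (y - μ)))) (Real.rpow_nonneg hp.le (-(n : ℝ) / 2))]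
  rw [lintegral_const_mul' _ _ ENNReal.ofReal_ne_top,
    lintegral_exp_neg_mul_sqNorm_sub_const (by positivity), ← ENNReal.ofReal_mul (by positivity)]
  rw [show Real.pi / (1 / (2 * v)) = 2 * Real.pi * v by field_simp, ← Real.rpow_add hp]
  ring_nf
  simp

/-- The power only divides the exponent by δ, so the normalized result is the normal density of
variance δv. -/
theorem powerLikelihood_eq {δ : ℝ} (hδ : 0 < δ) (μ : Fin n → ℝ) {v : ℝ} (hv : 0 < v)
    (y : Fin n → ℝ) : powerLikelihood δ μ v y = normalDensity μ (δ * v) y := by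
  have hδv : 0 < δ * v := mul_pos hδ hv
  have h2 : (0 : ℝ) < 2 * Real.pi * v := by positivity
  have h3 : (0 : ℝ) < 2 * Real.pi * (δ * v) := by positivity
  obtain ⟨K, hK, h⟩ : ∃ K : ℝ, 0 < K ∧ ∀ z : Fin n → ℝ,
      normalDensity μ v z ^ (1 / δ) = ENNReal.ofReal K * normalDensity μ (δ * v) z := by
    refine ⟨((2 * Real.pi * v) ^ (-(n : ℝ) / 2)) ^ (1 / δ)
      * ((2 * Real.pi * (δ * v)) ^ (-(n : ℝ) / 2))⁻¹, by positivity, fun z => ?_⟩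
    rw [normalDensity_eq μ hv, normalDensity_eq μ hδv,
      ENNReal.ofReal_rpow_of_pos (by positivity), ← ENNReal.ofReal_mul (by positivity),
      Real.mul_rpow (by positivity) (by positivity), ← Real.exp_mul]
    congr 1
    have he : -(1 / (2 * v) * sqNorm (z - μ)) * (1 / δ)
        = -(1 / (2 * (δ * v)) * sqNorm (z - μ)) := by field_simp
    rw [he]
    have : (2 * Real.pi * (δ * v)) ^ (-(n : ℝ) / 2) ≠ 0 := by positivity
    field_simp
  have hK0 : ENNReal.ofReal K ≠ 0 := (ENNReal.ofReal_pos.2 hK).ne'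
  simp_rw [powerLikelihood, h]
  rw [lintegral_const_mul' _ _ ENNReal.ofReal_ne_top, lintegral_normalDensity μ hδv, mul_one,
    mul_comm, ENNReal.mul_div_cancel_right hK0 ENNReal.ofReal_ne_top]

theorem pi_gaussianReal_eq_withDensity (μ : Fin n → ℝ) {v : ℝ≥0} (hv : 0 < v) :
    Measure.pi (fun i => gaussianReal (μ i) v) = volume.withDensity (normalDensity μ v) := by
  refine Measure.pi_eq fun s hs => ?_
  have h1 : ∀ y : Fin n → ℝ, (Set.univ.pi s).indicator (normalDensity μ v) y
      = ENNReal.ofReal (∏ i, (s i).indicator (gaussianPDFReal (μ i) v) (y i)) := by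
    intro y
    by_cases hy : y ∈ Set.univ.pi s
    · rw [Set.indicator_of_mem hy, normalDensity, Real.toNNReal_coe,
        ENNReal.ofReal_prod_of_nonneg fun i _ =>
          Set.indicator_nonneg (fun x _ => gaussianPDFReal_nonneg _ _ x) _]
      refine Finset.prod_congr rfl fun i _ => ?_
      rw [Set.indicator_of_mem (hy i trivial), gaussianPDF_def]
    · rw [Set.indicator_of_notMem hy]
      obtain ⟨i, hi⟩ : ∃ i, y i ∉ s i := by simpa [Set.mem_pi] using hy
      rw [Finset.prod_eq_zero (Finset.mem_univ i) (Set.indicator_of_notMem hi _),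
        ENNReal.ofReal_zero]
  have hint : ∀ i, Integrable ((s i).indicator (gaussianPDFReal (μ i) v)) := fun i =>
    (integrable_gaussianPDFReal _ _).indicator (hs i)
  have hnn : ∀ i x, 0 ≤ (s i).indicator (gaussianPDFReal (μ i) v) x := fun i x =>
    Set.indicator_nonneg (fun x _ => gaussianPDFReal_nonneg _ _ x) x
  rw [withDensity_apply _ (MeasurableSet.univ_pi hs),
    ← lintegral_indicator (MeasurableSet.univ_pi hs)]
  simp_rw [h1]
  rw [← ofReal_integral_eq_lintegral_ofReal (by
      rw [volume_pi]; exact Integrable.fintype_prod hint)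
      (Eventually.of_forall fun y => Finset.prod_nonneg fun i _ => hnn i _),
    integral_fintype_prod_volume_eq_prod, ENNReal.ofReal_prod_of_nonneg fun i _ =>
      integral_nonneg (hnn i)]
  refine Finset.prod_congr rfl fun i _ => ?_
  rw [ofReal_integral_eq_lintegral_ofReal (hint i) (Eventually.of_forall (hnn i)),
    gaussianReal_apply _ hv.ne', ← lintegral_indicator (hs i)]
  refine lintegral_congr fun x => ?_
  by_cases hx : x ∈ s i <;> simp [hx, gaussianPDF_def]

theorem lintegral_pi_gaussianReal (μ : Fin n → ℝ) {v : ℝ≥0} (hv : 0 < v)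
    {g : (Fin n → ℝ) → ℝ≥0∞} (hg : Measurable g) :
    ∫⁻ y, g y ∂(Measure.pi fun i => gaussianReal (μ i) v)
      = ∫⁻ y, normalDensity μ v y * g y := by
  rw [pi_gaussianReal_eq_withDensity μ hv,
    lintegral_withDensity_eq_lintegral_mul _ (measurable_normalDensity _ _) hg]
  rfl

/-- Coordinates are uncorrelated with variance v, so only the diagonal of B contributes.
Nonnegativity of the form is what turns the Bochner integral into a lower integral. -/
theorem lintegral_pi_gaussianReal_quadratic (μ : Fin n → ℝ) (v : ℝ≥0)
    (B : Matrix (Fin n) (Fin n) ℝ) (hB : ∀ x : Fin n → ℝ, 0 ≤ x ⬝ᵥ (B *ᵥ x)) :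
    ∫⁻ y, ENNReal.ofReal ((y - μ) ⬝ᵥ (B *ᵥ (y - μ)))
        ∂(Measure.pi fun i => gaussianReal (μ i) v) = ENNReal.ofReal (v * B.trace) := by
  set P := Measure.pi fun i => gaussianReal (μ i) v with hP
  have hL2 : ∀ i, MemLp (fun x : ℝ => x - μ i) 2 (gaussianReal (μ i) v) := fun i =>
    (memLp_id_gaussianReal' 2 (by simp)).sub (memLp_const _)
  have hL2' : ∀ i, MemLp (fun y : Fin n → ℝ => y i - μ i) 2 P := fun i =>
    (hL2 i).comp_measurePreserving (measurePreserving_eval _ i)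
  have hcomp : ∀ i (g : ℝ → ℝ), Continuous g →
      ∫ y, g (y i) ∂P = ∫ x, g x ∂gaussianReal (μ i) v := by
    intro i g hg
    rw [← (measurePreserving_eval (fun i => gaussianReal (μ i) v) i).map_eq,
      integral_map (measurable_pi_apply i).aemeasurable hg.aestronglyMeasurable]
  have hmean : ∀ i, ∫ y, (y i - μ i) ∂P = 0 := by
    intro i
    have hid : Integrable (fun x : ℝ => x) (gaussianReal (μ i) v) :=
      (memLp_id_gaussianReal' 1 (by simp)).integrable le_rfl
    rw [hcomp i (fun x => x - μ i) (by fun_prop), integral_sub hid (integrable_const _)]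
    simp
  have hprod : ∀ i k, ∫ y, (y i - μ i) * (y k - μ k) ∂P = if i = k then (v : ℝ) else 0 := by
    intro i k
    split_ifs with hik
    · subst hik
      rw [hcomp i (fun x => (x - μ i) * (x - μ i)) (by fun_prop)]
      have := variance_fun_id_gaussianReal (μ := μ i) (v := v)
      rw [variance_eq_integral (by fun_prop), integral_id_gaussianReal] at this
      simpa only [sq] using this
    · have hind := (iIndepFun_pi (μ := fun i => gaussianReal (μ i) v)
        (X := fun i x => x - μ i) fun i => by fun_prop).indepFun hik
      have := hind.integral_mul_eq_mul_integral (hL2' i).aestronglyMeasurable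
        (hL2' k).aestronglyMeasurable
      rw [hmean i, zero_mul] at this
      exact this
  have hint : ∀ i k, Integrable (fun y : Fin n → ℝ => (y i - μ i) * (y k - μ k)) P := fun i k =>
    (hL2' i).integrable_mul (hL2' k)
  have hexp : ∀ y : Fin n → ℝ, (y - μ) ⬝ᵥ (B *ᵥ (y - μ))
      = ∑ i, ∑ k, B i k * ((y i - μ i) * (y k - μ k)) := by
    intro y
    simp only [dotProduct, Matrix.mulVec, Finset.mul_sum, Pi.sub_apply]
    refine Finset.sum_congr rfl fun i _ => Finset.sum_congr rfl fun k _ => by ring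
  have hintegrable : ∀ i, Integrable
      (fun y : Fin n → ℝ => ∑ k, B i k * ((y i - μ i) * (y k - μ k))) P := fun i =>
    integrable_finsetSum _ fun k _ => (hint i k).const_mul _
  have hval : ∫ y, (y - μ) ⬝ᵥ (B *ᵥ (y - μ)) ∂P = v * B.trace := by
    simp_rw [hexp]
    rw [integral_finsetSum _ fun i _ => hintegrable i, Matrix.trace, Finset.mul_sum]
    refine Finset.sum_congr rfl fun i _ => ?_
    rw [integral_finsetSum _ fun k _ => (hint i k).const_mul _]
    simp_rw [integral_const_mul, hprod]
    simp [mul_comm]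
  rw [← hval, ofReal_integral_eq_lintegral_ofReal _ (Eventually.of_forall fun y => hB _)]
  simp_rw [hexp]
  exact integrable_finsetSum _ fun i _ => hintegrable i

end NormalDensity

/-! ### Laplace transform and negative moments of the residual sum of squares. -/

section Moments

variable {n : ℕ} {ι : Type*} [Fintype ι] [DecidableEq ι] {A : Matrix (Fin n) ι ℝ}

theorem mul_sqNorm_sub_add_mul_sqNorm_sub {t u : ℝ} (h : u + t ≠ 0) (z a b : Fin n → ℝ) :
    u * sqNorm (z - a) + t * sqNorm (z - b)
      = (u + t) * sqNorm (z - (u + t)⁻¹ • (u • a + t • b)) + u * t / (u + t) * sqNorm (b - a) := by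
  simp only [sqNorm_sub, sqNorm_smul, sqNorm_add, dotProduct_add, dotProduct_smul, smul_dotProduct,
    smul_eq_mul, dotProduct_comm b a]
  field_simp
  ring

theorem lintegral_normalDensity_mul_exp_neg_sqNorm {v u : ℝ} (hv : 0 < v) (hu : 0 < u)
    (a b : Fin n → ℝ) :
    ∫⁻ z, normalDensity b v z * ENNReal.ofReal (Real.exp (-(u * sqNorm (z - a))))
      = ENNReal.ofReal ((1 + 2 * v * u) ^ (-(n : ℝ) / 2)
          * Real.exp (-(u / (1 + 2 * v * u) * sqNorm (b - a)))) := by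
  have hp : (0 : ℝ) < 2 * Real.pi * v := by positivity
  set t : ℝ := 1 / (2 * v) with ht
  have ht0 : 0 < t := by positivity
  have hut : 0 < u + t := by positivity
  have h : ∀ z, normalDensity b v z * ENNReal.ofReal (Real.exp (-(u * sqNorm (z - a))))
      = ENNReal.ofReal ((2 * Real.pi * v) ^ (-(n : ℝ) / 2)
          * Real.exp (-(u * t / (u + t) * sqNorm (b - a))))
        * ENNReal.ofReal (Real.exp (-((u + t) * sqNorm (z - (u + t)⁻¹ • (u • a + t • b))))) := by
    intro z
    rw [normalDensity_eq b hv, ← ENNReal.ofReal_mul (by positivity),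
      ← ENNReal.ofReal_mul (by positivity), mul_assoc _ (Real.exp _) (Real.exp _), ← Real.exp_add,
      mul_assoc _ (Real.exp _) (Real.exp _), ← Real.exp_add, ← ht]
    congr 3
    linarith [mul_sqNorm_sub_add_mul_sqNorm_sub hut.ne' z a b]
  simp_rw [h]
  rw [lintegral_const_mul' _ _ ENNReal.ofReal_ne_top, lintegral_exp_neg_mul_sqNorm_sub_const hut,
    ← ENNReal.ofReal_mul (by positivity), mul_right_comm]
  congr 2
  · have e : Real.pi / (u + t) = (2 * Real.pi * v) * (1 + 2 * v * u)⁻¹ := by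
      rw [ht]; field_simp; ring
    rw [e, Real.mul_rpow hp.le (by positivity), ← mul_assoc, ← Real.rpow_add hp,
      Real.inv_rpow (by positivity), ← Real.rpow_neg (by positivity)]
    have : -(n : ℝ) / 2 + n / 2 = 0 := by ring
    rw [this, Real.rpow_zero, one_mul, neg_div]
  · have e : u * t / (u + t) = u / (1 + 2 * v * u) := by
      rw [ht]; field_simp; ring
    rw [e]

/-- This is the chi-square Laplace transform with n - d degrees of freedom, obtained without
diagonalizing the projection: up to a constant, exp(-u RSS) is the integral of exp(-u‖z - Ab‖²) over
b. After exchanging the integrals, the z-integral follows by completing the square and the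
b-integral is again Gaussian. -/
theorem lintegral_normalDensity_mul_exp_neg_rss (hA : LinearIndependent ℝ A.col) (b₀ : ι → ℝ)
    {v u : ℝ} (hv : 0 < v) (hu : 0 < u) :
    ∫⁻ z, normalDensity (A *ᵥ b₀) v z * ENNReal.ofReal (Real.exp (-(u * rss A z)))
      = ENNReal.ofReal ((1 + 2 * v * u) ^ (-((n : ℝ) - Fintype.card ι) / 2)) := by
  have hD := coefMass_pos hA
  have hw : 0 < 1 + 2 * v * u := by positivity
  set d : ℝ := (Fintype.card ι : ℝ) with hd
  have hcont : Continuous fun x : (Fin n → ℝ) × (ι → ℝ) => sqNorm (x.1 - A *ᵥ x.2) :=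
    continuous_sqNorm.comp (continuous_fst.sub
      (Continuous.matrix_mulVec continuous_const continuous_snd))
  have hmeas : Measurable fun x : (Fin n → ℝ) × (ι → ℝ) => normalDensity (A *ᵥ b₀) v x.1 *
      ENNReal.ofReal (Real.exp (-(u * sqNorm (x.1 - A *ᵥ x.2)))) :=
    ((measurable_normalDensity _ _).comp measurable_fst).mul
      (hcont.measurable.const_mul u).neg.exp.ennreal_ofReal
  have hK : 0 < u ^ (-d / 2) * coefMass A := by positivity
  have hK0 : ENNReal.ofReal (u ^ (-d / 2) * coefMass A) ≠ 0 := (ENNReal.ofReal_pos.2 hK).ne'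
  refine (ENNReal.mul_left_inj hK0 ENNReal.ofReal_ne_top).1 ?_
  rw [← lintegral_mul_const' _ _ ENNReal.ofReal_ne_top]
  have h1 : ∀ z, normalDensity (A *ᵥ b₀) v z * ENNReal.ofReal (Real.exp (-(u * rss A z)))
        * ENNReal.ofReal (u ^ (-d / 2) * coefMass A)
      = ∫⁻ b : ι → ℝ, normalDensity (A *ᵥ b₀) v z *
          ENNReal.ofReal (Real.exp (-(u * sqNorm (z - A *ᵥ b)))) := by
    intro z
    rw [lintegral_const_mul' _ _ (normalDensity_ne_top _ hv z), lintegral_exp_neg_mul_sqNorm_sub hA hu, mul_assoc,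
      ← ENNReal.ofReal_mul (Real.exp_pos _).le, mul_assoc]
  simp_rw [h1]
  rw [lintegral_lintegral_swap hmeas.aemeasurable]
  simp_rw [lintegral_normalDensity_mul_exp_neg_sqNorm hv hu,
    fun x : ι → ℝ => ENNReal.ofReal_mul
      (q := Real.exp (-(u / (1 + 2 * v * u) * sqNorm (A *ᵥ b₀ - A *ᵥ x))))
      (Real.rpow_nonneg hw.le (-(n : ℝ) / 2))]
  rw [lintegral_const_mul' _ _ ENNReal.ofReal_ne_top,
    lintegral_exp_neg_mul_sqNorm_sub hA (by positivity), rss_mulVec hA,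
    ← ENNReal.ofReal_mul (by positivity), ← ENNReal.ofReal_mul (by positivity)]
  congr 1
  rw [mul_zero, neg_zero, Real.exp_zero, one_mul, Real.div_rpow hu.le hw.le,
    ← mul_assoc, ← mul_assoc]
  congr 1
  rw [← hd, div_eq_mul_inv (u ^ _), ← Real.rpow_neg hw.le, mul_comm (u ^ _), ← mul_assoc,
    ← Real.rpow_add hw]
  congr 2
  ring

/-- Write R^(-q) as a Gamma integral in u of exp(-uR), and the Laplace transform (1 + 2vu)^(-s) as a
Gamma integral in t. Integrating u first gives Γ(q)(2vt)^(-q), after which t gives Γ(s - q); this is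
where q < s is needed. -/
theorem lintegral_normalDensity_mul_rss_rpow_neg (hA : LinearIndependent ℝ A.col) (b₀ : ι → ℝ)
    {v q : ℝ} (hv : 0 < v) (hq : 0 < q) (hqn : q < ((n : ℝ) - Fintype.card ι) / 2) :
    ∫⁻ z, normalDensity (A *ᵥ b₀) v z * ENNReal.ofReal (rss A z) ^ (-q)
      = ENNReal.ofReal ((2 * v) ^ (-q) * Real.Gamma (((n : ℝ) - Fintype.card ι) / 2 - q)
          / Real.Gamma (((n : ℝ) - Fintype.card ι) / 2)) := by
  set s : ℝ := ((n : ℝ) - Fintype.card ι) / 2 with hs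
  have hs0 : 0 < s := hq.trans hqn
  have hΓq := Real.Gamma_pos_of_pos hq
  have hΓs := Real.Gamma_pos_of_pos hs0
  have hK0 : ENNReal.ofReal (Real.Gamma q) ≠ 0 := (ENNReal.ofReal_pos.2 hΓq).ne'
  have hL0 : ENNReal.ofReal (Real.Gamma s) ≠ 0 := (ENNReal.ofReal_pos.2 hΓs).ne'
  refine (ENNReal.mul_right_inj hK0 ENNReal.ofReal_ne_top).1 ?_
  refine (ENNReal.mul_right_inj hL0 ENNReal.ofReal_ne_top).1 ?_
  have hr := (continuous_rss A).measurable
  rw [← lintegral_const_mul' _ _ ENNReal.ofReal_ne_top]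
  have h1 : ∀ z, ENNReal.ofReal (Real.Gamma q) *
      (normalDensity (A *ᵥ b₀) v z * ENNReal.ofReal (rss A z) ^ (-q))
      = ∫⁻ u in Set.Ioi (0 : ℝ), normalDensity (A *ᵥ b₀) v z *
          ENNReal.ofReal (u ^ (q - 1) * Real.exp (-(rss A z * u))) := by
    intro z
    rw [mul_left_comm, ← lintegral_rpow_mul_exp_neg hq (rss_nonneg hA z),
      lintegral_const_mul _ (by fun_prop)]
  simp_rw [h1]
  rw [lintegral_lintegral_swap (by
    refine Measurable.aemeasurable (((measurable_normalDensity _ _).comp measurable_fst).mul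
      (Measurable.ennreal_ofReal ?_))
    exact (measurable_snd.pow_const (q - 1)).mul
      ((hr.comp measurable_fst).mul measurable_snd).neg.exp),
    ← lintegral_const_mul' _ _ ENNReal.ofReal_ne_top]
  have h2 : ∀ u ∈ Set.Ioi (0 : ℝ), ENNReal.ofReal (Real.Gamma s) *
      ∫⁻ z, normalDensity (A *ᵥ b₀) v z *
          ENNReal.ofReal (u ^ (q - 1) * Real.exp (-(rss A z * u)))
      = ∫⁻ t in Set.Ioi (0 : ℝ), ENNReal.ofReal (t ^ (s - 1) * Real.exp (-t))
          * ENNReal.ofReal (u ^ (q - 1) * Real.exp (-(2 * v * t * u))) := by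
    intro u hu
    have hu' : (0 : ℝ) < u := hu
    have hw : 0 < 1 + 2 * v * u := by positivity
    have e1 : ∀ z, normalDensity (A *ᵥ b₀) v z *
        ENNReal.ofReal (u ^ (q - 1) * Real.exp (-(rss A z * u)))
        = ENNReal.ofReal (u ^ (q - 1)) *
          (normalDensity (A *ᵥ b₀) v z * ENNReal.ofReal (Real.exp (-(u * rss A z)))) := by
      intro z
      rw [ENNReal.ofReal_mul (by positivity), mul_left_comm, mul_comm u]
    have e2 : ∀ t : ℝ, ENNReal.ofReal (t ^ (s - 1) * Real.exp (-t))
          * ENNReal.ofReal (u ^ (q - 1) * Real.exp (-(2 * v * t * u)))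
        = ENNReal.ofReal (u ^ (q - 1)) *
          ENNReal.ofReal (t ^ (s - 1) * Real.exp (-((1 + 2 * v * u) * t))) := by
      intro t
      rw [← ENNReal.ofReal_mul' (by positivity), ← ENNReal.ofReal_mul (by positivity)]
      congr 1
      rw [show -((1 + 2 * v * u) * t) = -t + -(2 * v * t * u) by ring, Real.exp_add]
      ring
    simp_rw [e1, e2]
    rw [lintegral_const_mul' _ _ ENNReal.ofReal_ne_top,
      lintegral_const_mul' _ _ ENNReal.ofReal_ne_top,
      lintegral_normalDensity_mul_exp_neg_rss hA b₀ hv hu', lintegral_rpow_mul_exp_neg hs0 hw.le,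
      ENNReal.ofReal_rpow_of_pos hw, mul_left_comm, neg_div]
  rw [setLIntegral_congr_fun measurableSet_Ioi h2, lintegral_lintegral_swap (by
    refine Measurable.aemeasurable ?_
    fun_prop)]
  have h3 : ∀ t ∈ Set.Ioi (0 : ℝ), ∫⁻ u in Set.Ioi (0 : ℝ),
      ENNReal.ofReal (t ^ (s - 1) * Real.exp (-t))
          * ENNReal.ofReal (u ^ (q - 1) * Real.exp (-(2 * v * t * u)))
      = ENNReal.ofReal (Real.Gamma q * (2 * v) ^ (-q)) *
        ENNReal.ofReal (t ^ (s - q - 1) * Real.exp (-(1 * t))) := by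
    intro t ht
    have ht' : (0 : ℝ) < t := ht
    have hvt : 0 < 2 * v * t := by positivity
    rw [lintegral_const_mul' _ _ ENNReal.ofReal_ne_top, lintegral_rpow_mul_exp_neg hq hvt.le,
      ENNReal.ofReal_rpow_of_pos hvt, ← ENNReal.ofReal_mul hΓq.le,
      ← ENNReal.ofReal_mul (by positivity), ← ENNReal.ofReal_mul (by positivity),
      Real.mul_rpow (by positivity) ht'.le, show s - q - 1 = s - 1 + -q by ring,
      Real.rpow_add ht', one_mul]
    congr 1
    ring
  rw [setLIntegral_congr_fun measurableSet_Ioi h3,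
    lintegral_const_mul' _ _ ENNReal.ofReal_ne_top,
    lintegral_rpow_mul_exp_neg (by linarith) zero_le_one, ENNReal.ofReal_one, ENNReal.one_rpow,
    mul_one, ← ENNReal.ofReal_mul (by positivity), ← ENNReal.ofReal_mul hΓq.le,
    ← ENNReal.ofReal_mul hΓs.le]
  congr 1
  field_simp

end Moments

/-! ### Closed form of the prior predictive density; upper bound of the marginal likelihood. -/

section Marginals

variable {n : ℕ} {ι κ : Type*} [Fintype ι] [DecidableEq ι] [Fintype κ] [DecidableEq κ]
  {A : Matrix (Fin n) ι ℝ} {B : Matrix (Fin n) κ ℝ}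

/-- Half the residual degrees of freedom of the design matrix `A`. -/
def halfDof {n : ℕ} {ι : Type*} [Fintype ι] (_A : Matrix (Fin n) ι ℝ) : ℝ :=
  ((n : ℝ) - Fintype.card ι) / 2

/-- The constant of the prior predictive density under the baseline prior `1 / σ²`. -/
def predictiveConst {n : ℕ} {ι : Type*} [Fintype ι] (A : Matrix (Fin n) ι ℝ) : ℝ :=
  coefMass A * Real.pi ^ (-(n : ℝ) / 2) * Real.Gamma (halfDof A)

theorem predictiveConst_pos {α : Type*} [Fintype α] {A : Matrix (Fin n) α ℝ}
    (hA : LinearIndependent ℝ A.col) (hs : 0 < halfDof A) :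
    0 < predictiveConst A := by
  have := coefMass_pos hA
  have := Real.Gamma_pos_of_pos hs
  unfold predictiveConst; positivity

theorem lintegral_normalDensity_mulVec (hA : LinearIndependent ℝ A.col) {v : ℝ} (hv : 0 < v)
    (y : Fin n → ℝ) :
    ∫⁻ b : ι → ℝ, normalDensity (A *ᵥ b) v y
      = ENNReal.ofReal (coefMass A * Real.pi ^ (-(n : ℝ) / 2) *
          ((2 * v) ^ (-halfDof A) * Real.exp (-(rss A y / (2 * v))))) := by
  have h2v : 0 < 2 * v := by positivity
  simp_rw [normalDensity_eq _ hv, fun b : ι → ℝ => ENNReal.ofReal_mul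
      (q := Real.exp (-(1 / (2 * v) * sqNorm (y - A *ᵥ b))))
      (Real.rpow_nonneg (show 0 ≤ 2 * Real.pi * v by positivity) (-(n : ℝ) / 2))]
  rw [lintegral_const_mul' _ _ ENNReal.ofReal_ne_top,
    lintegral_exp_neg_mul_sqNorm_sub hA (by positivity), ← ENNReal.ofReal_mul (by positivity)]
  congr 1
  rw [show 2 * Real.pi * v = Real.pi * (2 * v) by ring, Real.mul_rpow Real.pi_pos.le h2v.le,
    one_div, Real.inv_rpow h2v.le, ← Real.rpow_neg h2v.le, inv_mul_eq_div,
    show -halfDof A = -(n : ℝ) / 2 + -(-(Fintype.card ι : ℝ) / 2) by unfold halfDof; ring,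
    Real.rpow_add h2v]
  ring

theorem priorPredictive_eq (hA : LinearIndependent ℝ A.col) (hs : 0 < halfDof A) {δ c : ℝ}
    (hδ : 0 < δ) (hc : 0 < c) (y : Fin n → ℝ) :
    priorPredictive δ c A y
      = ENNReal.ofReal (c * predictiveConst A) * ENNReal.ofReal (rss A y) ^ (-halfDof A) := by
  have hD := coefMass_pos hA
  have h : ∀ v ∈ Set.Ioi (0 : ℝ),
      ∫⁻ b : ι → ℝ, powerLikelihood δ (A *ᵥ b) v y * jeffreysPrior c v
      = ENNReal.ofReal (c * (coefMass A * Real.pi ^ (-(n : ℝ) / 2))) *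
        ENNReal.ofReal (v⁻¹ * (2 * δ * v) ^ (-halfDof A) *
          Real.exp (-(rss A y / (2 * δ * v)))) := by
    intro v hv
    have hv' : (0 : ℝ) < v := hv
    simp_rw [powerLikelihood_eq hδ _ hv']
    rw [lintegral_mul_const' _ _ (by exact ENNReal.ofReal_ne_top),
      lintegral_normalDensity_mulVec hA (by positivity), jeffreysPrior,
      ← ENNReal.ofReal_mul (by positivity), ← ENNReal.ofReal_mul (by positivity), ← mul_assoc 2]
    congr 1
    field_simp
  rw [priorPredictive, setLIntegral_congr_fun measurableSet_Ioi h,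
    lintegral_const_mul' _ _ ENNReal.ofReal_ne_top,
    lintegral_inv_mul_rpow_mul_exp hs (rss_nonneg hA y) (by positivity), ← mul_assoc,
    ← ENNReal.ofReal_mul (by positivity), predictiveConst]
  congr 2
  ring

/-- Up to a constant, the ratio of the prior predictive densities of the reference design `B` and
of the design `A`. -/
def predictiveRatio (A : Matrix (Fin n) ι ℝ) (B : Matrix (Fin n) κ ℝ) (z : Fin n → ℝ) : ℝ≥0∞ :=
  ENNReal.ofReal (rss A z) ^ halfDof A * ENNReal.ofReal (rss B z) ^ (-halfDof B)

/-- The constant c occurs in the baseline prior and in its predictive density and cancels; only c₀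
survives. -/
theorem pepPrior_eq (hA : LinearIndependent ℝ A.col) (hB : LinearIndependent ℝ B.col)
    (hs : 0 < halfDof A) (hs₀ : 0 < halfDof B) {δ c c₀ v : ℝ} (hδ : 0 < δ) (hc : 0 < c)
    (hc₀ : 0 < c₀) (hv : 0 < v) (b : ι → ℝ) :
    pepPrior δ c c₀ A B b v
      = ENNReal.ofReal (c₀ * predictiveConst B / predictiveConst A / v) *
        ∫⁻ z, normalDensity (A *ᵥ b) (δ * v) z * predictiveRatio A B z := by
  have hK := predictiveConst_pos hA hs
  have hK₀ := predictiveConst_pos hB hs₀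
  have hcK : 0 < c * predictiveConst A := by positivity
  rw [pepPrior, ← lintegral_const_mul' _ _ ENNReal.ofReal_ne_top]
  refine lintegral_congr fun z => ?_
  rw [powerLikelihood_eq hδ _ hv, priorPredictive_eq hA hs hδ hc, priorPredictive_eq hB hs₀ hδ hc₀,
    div_eq_mul_inv, ENNReal.mul_inv (Or.inl (ENNReal.ofReal_pos.2 hcK).ne')
      (Or.inl ENNReal.ofReal_ne_top), ENNReal.rpow_neg, inv_inv, jeffreysPrior,
    ← ENNReal.ofReal_inv_of_pos hcK, predictiveRatio]
  have : c₀ * predictiveConst B / predictiveConst A / v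
      = c / v * (c * predictiveConst A)⁻¹ * (c₀ * predictiveConst B) := by
    field_simp
  rw [this, ENNReal.ofReal_mul (p := c / v * (c * predictiveConst A)⁻¹) (by positivity),
    ENNReal.ofReal_mul (p := c / v) (by positivity)]
  generalize ENNReal.ofReal (c / v) = x₁, ENNReal.ofReal (c * predictiveConst A)⁻¹ = x₂,
    ENNReal.ofReal (c₀ * predictiveConst B) = x₃
  ring

/-- Replace RSS_B by the smaller RSS_A in the negative power. -/
theorem predictiveRatio_le (hA : LinearIndependent ℝ A.col) (hB : LinearIndependent ℝ B.col)
    (hAB : hatMatrix A * B = B) (hs : 0 < halfDof A) (hs₀ : 0 < halfDof B) (z : Fin n → ℝ) :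
    predictiveRatio A B z ≤ ENNReal.ofReal (rss A z) ^ (-(halfDof B - halfDof A)) := by
  unfold predictiveRatio
  rcases (rss_nonneg hA z).eq_or_lt with h | h
  -- With RSS_A = 0 the first factor is 0, and 0 * ∞ = 0 covers an infinite second factor.
  · rw [← h, ENNReal.ofReal_zero, ENNReal.zero_rpow_of_pos hs, zero_mul]
    exact zero_le
  · have hle := rss_le_rss hA hB hAB z
    have h₀ := h.trans_le hle
    rw [ENNReal.ofReal_rpow_of_pos h, ENNReal.ofReal_rpow_of_pos h, ENNReal.ofReal_rpow_of_pos h₀,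
      ← ENNReal.ofReal_mul (by positivity), show -(halfDof B - halfDof A)
        = halfDof A + -halfDof B by ring, Real.rpow_add h]
    gcongr ENNReal.ofReal (_ * ?_)
    exact Real.rpow_le_rpow_of_nonpos h hle (by linarith)

/-- The bound does not depend on b, so in the marginal likelihood the coefficients are integrated
against the likelihood alone. -/
theorem pepPrior_le (hA : LinearIndependent ℝ A.col) (hB : LinearIndependent ℝ B.col)
    (hAB : hatMatrix A * B = B) (hdof : halfDof A ≤ halfDof B)
    (hs : halfDof B - halfDof A < halfDof A) {δ c c₀ v : ℝ} (hδ : 0 < δ) (hc : 0 < c)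
    (hc₀ : 0 < c₀) (hv : 0 < v) (b : ι → ℝ) :
    pepPrior δ c c₀ A B b v
      ≤ ENNReal.ofReal (c₀ * predictiveConst B / predictiveConst A / v *
          ((2 * (δ * v)) ^ (-(halfDof B - halfDof A)) *
            Real.Gamma (halfDof A - (halfDof B - halfDof A)) / Real.Gamma (halfDof A))) := by
  have hsA : 0 < halfDof A := by linarith
  have hsB : 0 < halfDof B := by linarith
  have hK := predictiveConst_pos hA hsA
  have hK₀ := predictiveConst_pos hB hsB
  have hΓ := Real.Gamma_pos_of_pos hsA
  rw [pepPrior_eq hA hB hsA hsB hδ hc hc₀ hv, ENNReal.ofReal_mul (by positivity)]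
  gcongr
  refine (lintegral_mono fun z => mul_le_mul_right
    (predictiveRatio_le hA hB hAB hsA hsB z) _).trans ?_
  -- The moment formula needs a positive exponent; for equal dimensions the integrand reduces to the
  -- density itself.
  rcases (sub_nonneg.2 hdof).eq_or_lt with h | h
  · rw [← h]
    simp [lintegral_normalDensity _ (mul_pos hδ hv), hΓ.ne']
  · exact (lintegral_normalDensity_mul_rss_rpow_neg hA b (mul_pos hδ hv) h hs).le

/-- Integrating b produces `coefMass A`, which cancels against `predictiveConst A`. The powers
v^(-s_A) and v^(-h) combine to v^(-s_B), so the exponent of RSS_A(y) is that of the reference model.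
-/
theorem pepMarginal_le (hA : LinearIndependent ℝ A.col) (hB : LinearIndependent ℝ B.col)
    (hAB : hatMatrix A * B = B) (hdof : halfDof A ≤ halfDof B)
    (hs : halfDof B - halfDof A < halfDof A) {δ c c₀ : ℝ} (hδ : 0 < δ) (hc : 0 < c)
    (hc₀ : 0 < c₀) (y : Fin n → ℝ) :
    pepMarginal δ c c₀ A A B y
      ≤ ENNReal.ofReal (c₀ * predictiveConst B * Real.Gamma (halfDof B) *
          (δ ^ (-(halfDof B - halfDof A)) * Real.Gamma (halfDof A - (halfDof B - halfDof A))
            / Real.Gamma (halfDof A) ^ 2)) * ENNReal.ofReal (rss A y) ^ (-halfDof B) := by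
  have hsA : 0 < halfDof A := by linarith
  have hsB : 0 < halfDof B := by linarith
  have hD := coefMass_pos hA
  have hK := predictiveConst_pos hA hsA
  have hK₀ := predictiveConst_pos hB hsB
  have hΓ := Real.Gamma_pos_of_pos hsA
  have hΓB := Real.Gamma_pos_of_pos hsB
  have hΓh := Real.Gamma_pos_of_pos (sub_pos.2 hs)
  set h := halfDof B - halfDof A with hh
  have h1 : ∀ v ∈ Set.Ioi (0 : ℝ),
      ∫⁻ b : ι → ℝ, normalDensity (A *ᵥ b) v y * pepPrior δ c c₀ A B b v
      ≤ ENNReal.ofReal (c₀ * predictiveConst B *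
          (δ ^ (-h) * Real.Gamma (halfDof A - h) / Real.Gamma (halfDof A) ^ 2)) *
        ENNReal.ofReal (v⁻¹ * (2 * v) ^ (-halfDof B) * Real.exp (-(rss A y / (2 * v)))) := by
    intro v hv
    have hv' : (0 : ℝ) < v := hv
    refine (lintegral_mono fun b => mul_le_mul_right
      (pepPrior_le hA hB hAB hdof hs hδ hc hc₀ hv' b) _).trans_eq ?_
    rw [lintegral_mul_const' _ _ ENNReal.ofReal_ne_top, lintegral_normalDensity_mulVec hA hv',
      ← ENNReal.ofReal_mul (by positivity), ← ENNReal.ofReal_mul (by positivity), ← hh]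
    congr 1
    rw [show 2 * (δ * v) = δ * (2 * v) by ring, Real.mul_rpow hδ.le (by positivity),
      show -halfDof B = -halfDof A + -h by rw [hh]; ring, Real.rpow_add (by positivity)]
    nth_rewrite 2 [predictiveConst]
    field_simp
  refine (setLIntegral_mono' measurableSet_Ioi h1).trans_eq ?_
  rw [lintegral_const_mul' _ _ ENNReal.ofReal_ne_top,
    lintegral_inv_mul_rpow_mul_exp hsB (rss_nonneg hA y) two_pos, ← mul_assoc,
    ← ENNReal.ofReal_mul (by positivity)]
  congr 2
  ring

end Marginals

/-! ### Lower bound for the mean predictive ratio. -/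

section LowerBound

variable {n : ℕ} {ι κ : Type*} [Fintype ι] [DecidableEq ι] [Fintype κ] [DecidableEq κ]
  {A : Matrix (Fin n) ι ℝ} {B : Matrix (Fin n) κ ℝ}

theorem lintegral_normalDensity_quadratic (μ : Fin n → ℝ) {v : ℝ} (hv : 0 < v)
    (M : Matrix (Fin n) (Fin n) ℝ) (hM : ∀ x : Fin n → ℝ, 0 ≤ x ⬝ᵥ (M *ᵥ x)) :
    ∫⁻ z, normalDensity μ v z * ENNReal.ofReal ((z - μ) ⬝ᵥ (M *ᵥ (z - μ)))
      = ENNReal.ofReal (v * M.trace) := by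
  have h := lintegral_pi_gaussianReal_quadratic μ ⟨v, hv.le⟩ M hM
  rw [lintegral_pi_gaussianReal μ (show (0 : ℝ≥0) < ⟨v, hv.le⟩ from hv) (by
    unfold dotProduct Matrix.mulVec dotProduct; fun_prop)] at h
  exact h

theorem lintegral_normalDensity_rss_le (hA : LinearIndependent ℝ A.col) (b : ι → ℝ) {v : ℝ}
    (hv : 0 < v) :
    ∫⁻ z, normalDensity (A *ᵥ b) v z * ENNReal.ofReal (rss A z) ≤ ENNReal.ofReal (v * n) := by
  have h := lintegral_normalDensity_quadratic (A *ᵥ b) hv 1 fun x => by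
    rw [Matrix.one_mulVec]; exact sqNorm_nonneg x
  rw [Matrix.trace_one, Fintype.card_fin] at h
  rw [← h]
  refine lintegral_mono fun z => mul_le_mul_right (ENNReal.ofReal_le_ofReal ?_) _
  rw [Matrix.one_mulVec]
  exact rss_le_sqNorm_sub hA z b

theorem trace_hatMatrix_sub (hA : LinearIndependent ℝ A.col) (hB : LinearIndependent ℝ B.col) :
    (hatMatrix A - hatMatrix B).trace = Fintype.card ι - Fintype.card κ := by
  rw [Matrix.trace_sub, trace_hatMatrix hA, trace_hatMatrix hB]

theorem IsProj.quadratic_le {P : Matrix (Fin n) (Fin n) ℝ} (hP : IsProj P) (x y : Fin n → ℝ) :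
    y ⬝ᵥ (P *ᵥ y) ≤ 2 * ((y - x) ⬝ᵥ (P *ᵥ (y - x))) + 2 * sqNorm (P *ᵥ x) := by
  rw [← hP.sqNorm_mulVec, ← hP.sqNorm_mulVec]
  have := sqNorm_add_le (P *ᵥ (y - x)) (P *ᵥ x)
  rwa [← Matrix.mulVec_add, sub_add_cancel] at this

theorem hatMatrix_sub_mulVec_eq (hA : LinearIndependent ℝ A.col) (b : ι → ℝ) :
    (hatMatrix A - hatMatrix B) *ᵥ (A *ᵥ b) = (1 - hatMatrix B) *ᵥ (A *ᵥ b) := by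
  rw [Matrix.mulVec_mulVec, Matrix.mulVec_mulVec, Matrix.sub_mul, Matrix.sub_mul,
    hatMatrix_mul_self hA, Matrix.one_mul]

/-- RSS_B - RSS_A is the squared length of the projection of z by H_A - H_B, whose trace is the
difference of dimensions. The factors 2 come from ‖x + y‖² ≤ 2‖x‖² + 2‖y‖², separating mean from
noise. -/
theorem lintegral_normalDensity_rss_sub_le (hA : LinearIndependent ℝ A.col)
    (hB : LinearIndependent ℝ B.col) (hAB : hatMatrix A * B = B) (b : ι → ℝ) {v : ℝ}
    (hv : 0 < v) :
    ∫⁻ z, normalDensity (A *ᵥ b) v z * ENNReal.ofReal (rss B z - rss A z)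
      ≤ ENNReal.ofReal (2 * (v * ((Fintype.card ι : ℝ) - Fintype.card κ))
          + 2 * rss B (A *ᵥ b)) := by
  have hP := isProj_hatMatrix_sub hA hB hAB
  have htr : 0 ≤ (hatMatrix A - hatMatrix B).trace := by
    refine Finset.sum_nonneg fun i _ => ?_
    simpa using hP.quadratic_nonneg (Pi.single i 1)
  have h := lintegral_normalDensity_quadratic (A *ᵥ b) hv _ hP.quadratic_nonneg
  have hle : ∀ z, ENNReal.ofReal (rss B z - rss A z)
      ≤ 2 * ENNReal.ofReal ((z - A *ᵥ b) ⬝ᵥ ((hatMatrix A - hatMatrix B) *ᵥ (z - A *ᵥ b)))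
        + ENNReal.ofReal (2 * rss B (A *ᵥ b)) := by
    intro z
    rw [rss_sub_rss, ← ENNReal.ofReal_ofNat 2, ← ENNReal.ofReal_mul zero_le_two,
      ← ENNReal.ofReal_add (mul_nonneg zero_le_two (hP.quadratic_nonneg _))
        (mul_nonneg zero_le_two (rss_nonneg hB _)), rss_eq_sqNorm hB,
        ← hatMatrix_sub_mulVec_eq hA]
    exact ENNReal.ofReal_le_ofReal (hP.quadratic_le _ _)
  refine (lintegral_mono fun z => mul_le_mul_right (hle z) _).trans_eq ?_
  simp_rw [mul_add]
  rw [lintegral_add_right _ ((measurable_normalDensity _ _).mul_const _),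
    lintegral_mul_const' _ _ ENNReal.ofReal_ne_top, lintegral_normalDensity _ hv, one_mul]
  simp_rw [mul_left_comm _ (2 : ℝ≥0∞)]
  rw [lintegral_const_mul' _ _ (by simp), h, trace_hatMatrix_sub hA hB,
    ← ENNReal.ofReal_ofNat 2, ← ENNReal.ofReal_mul zero_le_two, ← ENNReal.ofReal_add]
  · rw [← trace_hatMatrix_sub hA hB]; positivity
  · exact mul_nonneg zero_le_two (rss_nonneg hB _)

theorem lintegral_normalDensity_mul_inv_rss (hA : LinearIndependent ℝ A.col) (b : ι → ℝ) {v : ℝ}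
    (hv : 0 < v) (hs : 1 < halfDof A) :
    ∫⁻ z, normalDensity (A *ᵥ b) v z * (ENNReal.ofReal (rss A z))⁻¹
      = ENNReal.ofReal (1 / (2 * v * (halfDof A - 1))) := by
  have h := lintegral_normalDensity_mul_rss_rpow_neg hA b hv one_pos hs
  simp_rw [ENNReal.rpow_neg_one] at h
  rw [h]
  congr 1
  change (2 * v) ^ (-1 : ℝ) * Real.Gamma (halfDof A - 1) / Real.Gamma (halfDof A) = _
  have hΓ := Real.Gamma_pos_of_pos (sub_pos.2 hs)
  have hs' := sub_pos.2 hs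
  have : Real.Gamma (halfDof A) = (halfDof A - 1) * Real.Gamma (halfDof A - 1) := by
    rw [← Real.Gamma_add_one hs'.ne', sub_add_cancel]
  rw [this, Real.rpow_neg_one]
  field_simp

/-- The right side is R^(-h) (1 + W/R)^(-(s+h)); use log(1 + t) ≤ t. -/
theorem exp_le_rpow_mul_rpow_neg {s h R W x r : ℝ} (hs : 0 ≤ s) (hh : 0 ≤ h)
    (hR : 0 < R) (hRx : R ≤ x) (hW : 0 ≤ W) (hr : (s + h) * (W / R) ≤ r) :
    x ^ (-h) * Real.exp (-r) ≤ R ^ s * (R + W) ^ (-(s + h)) := by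
  have h1 : R + W = R * (1 + W / R) := by field_simp
  have hWR : 0 ≤ W / R := by positivity
  rw [h1, Real.mul_rpow hR.le (by positivity), ← mul_assoc, ← Real.rpow_add hR,
    show s + -(s + h) = -h by ring]
  refine mul_le_mul (Real.rpow_le_rpow_of_nonpos hR hRx (by linarith)) ?_ (Real.exp_pos _).le
    (by positivity)
  rw [Real.rpow_def_of_pos (by positivity)]
  refine Real.exp_le_exp.2 ?_
  have : Real.log (1 + W / R) ≤ W / R := by
    have := Real.log_le_sub_one_of_pos (show 0 < 1 + W / R by positivity)
    linarith
  nlinarith [mul_le_mul_of_nonneg_right this (show 0 ≤ s + h by positivity)]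

/-- On the event x/16 < RSS_A < 8x and RSS_B - RSS_A < w, with x = nv the typical size of RSS_A, the
ratio is at least F₀. Markov's inequality, with the three constraints summed in one statistic g,
gives this event probability at least 1/2. -/
theorem le_lintegral_predictiveRatio (hA : LinearIndependent ℝ A.col)
    (hB : LinearIndependent ℝ B.col) (hAB : hatMatrix A * B = B)
    (hcard : Fintype.card κ ≤ Fintype.card ι) (hn : 2 * Fintype.card ι + 4 ≤ n)
    (b : ι → ℝ) {v : ℝ} (hv : 0 < v) :
    ENNReal.ofReal (1 / 2 * ((8 * (n * v)) ^ (-(halfDof B - halfDof A)) *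
        Real.exp (-(128 * (rss B (A *ᵥ b) / v + (Fintype.card ι + 1))))))
      ≤ ∫⁻ z, normalDensity (A *ᵥ b) v z * predictiveRatio A B z := by
  have hcard' : (Fintype.card κ : ℝ) ≤ Fintype.card ι := by exact_mod_cast hcard
  have hn' : 2 * (Fintype.card ι : ℝ) + 4 ≤ n := by exact_mod_cast hn
  have hd0 : (0 : ℝ) ≤ Fintype.card κ := Nat.cast_nonneg _
  have hd : (0 : ℝ) ≤ Fintype.card ι := Nat.cast_nonneg _
  have hs : (n : ℝ) / 4 ≤ halfDof A - 1 := by unfold halfDof; linarith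
  have hsA : 0 < halfDof A := by unfold halfDof; linarith
  have hsB : 0 < halfDof B := by unfold halfDof; linarith
  have hsB' : halfDof B ≤ n / 2 := by unfold halfDof; linarith
  have hh : 0 ≤ halfDof B - halfDof A := by unfold halfDof; linarith
  have hn0 : (0 : ℝ) < n := by linarith
  have hQ := rss_nonneg hB (A *ᵥ b)
  set Q := rss B (A *ᵥ b) with hQdef
  set x : ℝ := n * v with hx
  have hx0 : 0 < x := by positivity
  -- At least eight times the mean bound of RSS_B - RSS_A; the `+ 1` keeps w positive when Q and the
  -- dimension vanish.
  set w : ℝ := 16 * (Q + (Fintype.card ι + 1) * v) with hw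
  have hw0 : 0 < w := by positivity
  -- The exponent is (n/2) · w/(x/16) = 8w/v, whence 128 = 8 · 16.
  set F₀ : ℝ := (8 * x) ^ (-(halfDof B - halfDof A)) *
    Real.exp (-(128 * (Q / v + (Fintype.card ι + 1)))) with hF₀
  have hF₀pos : 0 < F₀ := by positivity
  set g : (Fin n → ℝ) → ℝ≥0∞ := fun z => ENNReal.ofReal (x / 16) * (ENNReal.ofReal (rss A z))⁻¹
    + ENNReal.ofReal (1 / (8 * x)) * ENNReal.ofReal (rss A z)
    + ENNReal.ofReal (1 / w) * ENNReal.ofReal (rss B z - rss A z) with hg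
  -- Pointwise Markov: if g ≥ 1 the last term suffices, and g < 1 forces all three constraints.
  -- Integrating with E g ≤ 1/2 then leaves F₀/2.
  have hpt : ∀ z, ENNReal.ofReal F₀ ≤ predictiveRatio A B z + ENNReal.ofReal F₀ * g z := by
    intro z
    rcases le_or_gt 1 (g z) with h1 | h1
    · calc ENNReal.ofReal F₀ = ENNReal.ofReal F₀ * 1 := (mul_one _).symm
        _ ≤ ENNReal.ofReal F₀ * g z := by gcongr
        _ ≤ _ := le_add_self
    refine le_trans ?_ le_self_add
    have hA0 := rss_nonneg hA z
    have hAB0 := rss_le_rss hA hB hAB z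
    have g1 : ENNReal.ofReal (x / 16) * (ENNReal.ofReal (rss A z))⁻¹ < 1 :=
      lt_of_le_of_lt (le_self_add.trans le_self_add) h1
    have g2 : ENNReal.ofReal (1 / (8 * x)) * ENNReal.ofReal (rss A z) < 1 :=
      lt_of_le_of_lt (le_add_self.trans le_self_add) h1
    have g3 : ENNReal.ofReal (1 / w) * ENNReal.ofReal (rss B z - rss A z) < 1 :=
      lt_of_le_of_lt le_add_self h1
    have hRpos : 0 < rss A z := by
      rcases hA0.eq_or_lt with h | h
      · rw [← h, ENNReal.ofReal_zero, ENNReal.inv_zero,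
          ENNReal.mul_top (ENNReal.ofReal_pos.2 (by positivity)).ne'] at g1
        exact absurd g1 (by simp)
      · exact h
    rw [← ENNReal.ofReal_inv_of_pos hRpos, ← ENNReal.ofReal_mul (by positivity),
      ENNReal.ofReal_lt_one, ← div_eq_mul_inv, div_lt_one hRpos] at g1
    rw [← ENNReal.ofReal_mul (by positivity), ENNReal.ofReal_lt_one, one_div_mul_eq_div,
      div_lt_one (by positivity)] at g2
    rw [← ENNReal.ofReal_mul (by positivity), ENNReal.ofReal_lt_one, one_div_mul_eq_div,
      div_lt_one hw0] at g3
    unfold predictiveRatio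
    rw [ENNReal.ofReal_rpow_of_pos hRpos, ENNReal.ofReal_rpow_of_pos (hRpos.trans_le hAB0),
      ← ENNReal.ofReal_mul (by positivity)]
    refine ENNReal.ofReal_le_ofReal ?_
    have key := exp_le_rpow_mul_rpow_neg (s := halfDof A) (h := halfDof B - halfDof A)
      (R := rss A z) (W := rss B z - rss A z) (x := 8 * x)
      (r := 128 * (Q / v + (Fintype.card ι + 1))) hsA.le hh hRpos g2.le (by linarith) ?_
    · rwa [add_sub_cancel, add_sub_cancel] at key
    · have e1 : (rss B z - rss A z) / rss A z ≤ w / (x / 16) := by gcongr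
      calc (halfDof A + (halfDof B - halfDof A)) * ((rss B z - rss A z) / rss A z)
          ≤ (n / 2) * (w / (x / 16)) := by
            refine mul_le_mul (by linarith) e1 ?_ (by positivity)
            exact div_nonneg (by linarith) hA0
        _ = _ := by rw [hw, hx]; field_simp; ring
  have hEg : ∫⁻ z, normalDensity (A *ᵥ b) v z * g z ≤ ENNReal.ofReal (1 / 2) := by
    have hmA : Measurable fun z : Fin n → ℝ => ENNReal.ofReal (rss A z) :=
      (continuous_rss A).measurable.ennreal_ofReal
    have hmB : Measurable fun z : Fin n → ℝ => ENNReal.ofReal (rss B z - rss A z) :=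
      ((continuous_rss B).sub (continuous_rss A)).measurable.ennreal_ofReal
    have hN := measurable_normalDensity (A *ᵥ b) v
    have hmA' : Measurable fun z => ENNReal.ofReal (1 / (8 * x)) *
        (normalDensity (A *ᵥ b) v z * ENNReal.ofReal (rss A z)) := (hN.mul hmA).const_mul _
    have hmB' : Measurable fun z => ENNReal.ofReal (1 / w) *
        (normalDensity (A *ᵥ b) v z * ENNReal.ofReal (rss B z - rss A z)) :=
      (hN.mul hmB).const_mul _
    simp_rw [hg, mul_add, mul_left_comm (normalDensity _ _ _)]
    rw [lintegral_add_right _ hmB', lintegral_add_right _ hmA',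
      lintegral_const_mul' _ _ ENNReal.ofReal_ne_top,
      lintegral_const_mul' _ _ ENNReal.ofReal_ne_top,
      lintegral_const_mul' _ _ ENNReal.ofReal_ne_top,
      lintegral_normalDensity_mul_inv_rss hA b hv (by linarith)]
    have b1 : ENNReal.ofReal (x / 16) * ENNReal.ofReal (1 / (2 * v * (halfDof A - 1)))
        ≤ ENNReal.ofReal (1 / 8) := by
      rw [← ENNReal.ofReal_mul (by positivity)]
      refine ENNReal.ofReal_le_ofReal ?_
      have : 0 < halfDof A - 1 := by linarith
      rw [hx, mul_one_div, div_le_iff₀ (by positivity)]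
      nlinarith
    have b2 : ENNReal.ofReal (1 / (8 * x)) *
        ∫⁻ z, normalDensity (A *ᵥ b) v z * ENNReal.ofReal (rss A z) ≤ ENNReal.ofReal (1 / 8) := by
      refine (mul_le_mul_right (lintegral_normalDensity_rss_le hA b hv) _).trans_eq ?_
      rw [← ENNReal.ofReal_mul (by positivity), hx]
      congr 1
      field_simp
    have b3 : ENNReal.ofReal (1 / w) *
        ∫⁻ z, normalDensity (A *ᵥ b) v z * ENNReal.ofReal (rss B z - rss A z)
          ≤ ENNReal.ofReal (1 / 8) := by
      refine (mul_le_mul_right (lintegral_normalDensity_rss_sub_le hA hB hAB b hv) _).trans ?_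
      rw [← ENNReal.ofReal_mul (by positivity)]
      refine ENNReal.ofReal_le_ofReal ?_
      rw [one_div_mul_eq_div, div_le_iff₀ hw0, hw]
      nlinarith
    calc _ ≤ ENNReal.ofReal (1 / 8) + ENNReal.ofReal (1 / 8) + ENNReal.ofReal (1 / 8) := by
          gcongr
      _ = ENNReal.ofReal (3 / 8) := by
          rw [← ENNReal.ofReal_add (by norm_num) (by norm_num),
            ← ENNReal.ofReal_add (by norm_num) (by norm_num)]
          norm_num
      _ ≤ _ := ENNReal.ofReal_le_ofReal (by norm_num)
  have hsum : ENNReal.ofReal F₀ ≤ (∫⁻ z, normalDensity (A *ᵥ b) v z * predictiveRatio A B z)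
      + ENNReal.ofReal F₀ * ENNReal.ofReal (1 / 2) := by
    have hratio : Measurable (predictiveRatio A B) := by
      unfold predictiveRatio
      exact ((continuous_rss A).measurable.ennreal_ofReal.pow_const _).mul
        ((continuous_rss B).measurable.ennreal_ofReal.pow_const _)
    have hNratio : Measurable fun z => normalDensity (A *ᵥ b) v z * predictiveRatio A B z :=
      (measurable_normalDensity _ _).mul hratio
    calc ENNReal.ofReal F₀ = ∫⁻ z, normalDensity (A *ᵥ b) v z * ENNReal.ofReal F₀ := by
          rw [lintegral_mul_const' _ _ ENNReal.ofReal_ne_top, lintegral_normalDensity _ hv, one_mul]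
      _ ≤ ∫⁻ z, (normalDensity (A *ᵥ b) v z * predictiveRatio A B z
            + ENNReal.ofReal F₀ * (normalDensity (A *ᵥ b) v z * g z)) := by
          refine lintegral_mono fun z => ?_
          rw [mul_left_comm, ← mul_add]
          gcongr
          exact hpt z
      _ ≤ _ := by
          rw [lintegral_add_left hNratio,
            lintegral_const_mul' _ _ ENNReal.ofReal_ne_top]
          gcongr
  have hhalf : ENNReal.ofReal F₀ = ENNReal.ofReal (1 / 2 * F₀)
      + ENNReal.ofReal F₀ * ENNReal.ofReal (1 / 2) := by
    rw [← ENNReal.ofReal_mul hF₀pos.le, ← ENNReal.ofReal_add (by positivity) (by positivity)]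
    congr 1; ring
  have hfin : ENNReal.ofReal F₀ * ENNReal.ofReal (1 / 2) ≠ ∞ :=
    ENNReal.mul_ne_top ENNReal.ofReal_ne_top ENNReal.ofReal_ne_top
  exact (ENNReal.add_le_add_iff_right hfin).1 (hhalf ▸ hsum)

end LowerBound

/-! ### Ratios of Gamma values at half-integer shifts. -/

section GammaRatio

/-- Log-convexity of Γ at the midpoint of x and x + 1. -/
theorem Gamma_add_half_le {x : ℝ} (hx : 0 < x) :
    Real.Gamma (x + 1 / 2) ≤ Real.sqrt x * Real.Gamma x := by
  have hΓ := Real.Gamma_pos_of_pos hx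
  have h := Real.Gamma_mul_add_mul_le_rpow_Gamma_mul_rpow_Gamma hx (add_pos hx one_pos)
    one_half_pos one_half_pos (by norm_num)
  rw [Real.Gamma_add_one hx.ne', Real.mul_rpow hx.le hΓ.le, mul_left_comm, ← Real.rpow_add hΓ,
    ← Real.sqrt_eq_rpow x] at h
  norm_num at h
  rwa [show 1 / 2 * x + 1 / 2 * (x + 1) = x + 1 / 2 by ring] at h

/-- Induction by half steps. The upper bound is the midpoint inequality at x + k/2; the lower one is
the same inequality at x + k/2 + 1/2 combined with Γ(t + 1) = tΓ(t). -/
theorem exists_Gamma_ratio_bound (k : ℕ) : ∃ C : ℝ, 0 < C ∧ ∀ x : ℝ, 1 ≤ x →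
    Real.Gamma (x + k / 2) ≤ C * (x ^ ((k : ℝ) / 2) * Real.Gamma x) ∧
    x ^ ((k : ℝ) / 2) * Real.Gamma x ≤ C * Real.Gamma (x + k / 2) := by
  induction k with
  | zero => exact ⟨1, one_pos, fun x _ => by simp⟩
  | succ k ih =>
    obtain ⟨C, hC, h⟩ := ih
    have hk : (0 : ℝ) ≤ k := Nat.cast_nonneg k
    refine ⟨C * Real.sqrt (2 + k / 2), by positivity, fun x hx => ?_⟩
    obtain ⟨h1, h2⟩ := h x hx
    have hx0 : 0 < x := by linarith
    have hxk : 0 < x + k / 2 := by positivity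
    have hΓ := Real.Gamma_pos_of_pos hx0
    have hΓk := Real.Gamma_pos_of_pos hxk
    have hxs : x ^ (((k + 1 : ℕ) : ℝ) / 2) = x ^ ((k : ℝ) / 2) * Real.sqrt x := by
      rw [Real.sqrt_eq_rpow, ← Real.rpow_add hx0]; push_cast; ring_nf
    have hadd : x + ((k + 1 : ℕ) : ℝ) / 2 = x + k / 2 + 1 / 2 := by push_cast; ring
    rw [hxs, hadd]
    constructor
    · calc Real.Gamma (x + k / 2 + 1 / 2)
          ≤ Real.sqrt (x + k / 2) * Real.Gamma (x + k / 2) := Gamma_add_half_le hxk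
        _ ≤ Real.sqrt ((2 + k / 2) * x) * (C * (x ^ ((k : ℝ) / 2) * Real.Gamma x)) := by
            gcongr
            nlinarith
        _ = _ := by rw [Real.sqrt_mul (by positivity)]; ring
    · have h3 := Gamma_add_half_le (show 0 < x + k / 2 + 1 / 2 by positivity)
      rw [add_assoc, add_halves, Real.Gamma_add_one hxk.ne'] at h3
      have h4 : Real.sqrt (x + k / 2) * Real.Gamma (x + k / 2)
          ≤ Real.sqrt 2 * Real.Gamma (x + k / 2 + 1 / 2) := by
        have hs : 0 < Real.sqrt (x + k / 2) := Real.sqrt_pos.2 hxk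
        refine le_of_mul_le_mul_left ?_ hs
        calc Real.sqrt (x + k / 2) * (Real.sqrt (x + k / 2) * Real.Gamma (x + k / 2))
            = (x + k / 2) * Real.Gamma (x + k / 2) := by
              rw [← mul_assoc, Real.mul_self_sqrt hxk.le]
          _ ≤ _ := h3
          _ ≤ Real.sqrt (2 * (x + k / 2)) * Real.Gamma (x + k / 2 + 1 / 2) := by
              have := Real.Gamma_pos_of_pos (show 0 < x + k / 2 + 1 / 2 by positivity)
              gcongr
              linarith
          _ = _ := by rw [Real.sqrt_mul zero_le_two]; ring
      calc x ^ ((k : ℝ) / 2) * Real.sqrt x * Real.Gamma x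
          = Real.sqrt x * (x ^ ((k : ℝ) / 2) * Real.Gamma x) := by ring
        _ ≤ Real.sqrt (x + k / 2) * (C * Real.Gamma (x + k / 2)) := by
            gcongr; linarith
        _ = C * (Real.sqrt (x + k / 2) * Real.Gamma (x + k / 2)) := by ring
        _ ≤ C * (Real.sqrt 2 * Real.Gamma (x + k / 2 + 1 / 2)) := by gcongr
        _ ≤ C * (Real.sqrt (2 + k / 2) * Real.Gamma (x + k / 2 + 1 / 2)) := by
            have := Real.Gamma_pos_of_pos (show 0 < x + k / 2 + 1 / 2 by positivity)
            gcongr; linarith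
        _ = _ := by ring

end GammaRatio

/-! ### Lower bound of the marginal likelihood. -/

section MarginalBounds

variable {n : ℕ} {ι κ : Type*} [Fintype ι] [DecidableEq ι] [Fintype κ] [DecidableEq κ]

theorem halfDof_sub_halfDof {ι κ : Type*} [Fintype ι] [Fintype κ]
    (A : Matrix (Fin n) ι ℝ) (B : Matrix (Fin n) κ ℝ)
    (h : Fintype.card κ ≤ Fintype.card ι) :
    halfDof B - halfDof A = ((Fintype.card ι - Fintype.card κ : ℕ) : ℝ) / 2 := by
  rw [Nat.cast_sub h, halfDof, halfDof]; ring

/-- The prior's lower bound costs exp(-128 RSS_B(Ab)/(nv)). Since RSS_B(Ab) ≤ 2‖H_A y - Ab‖² + 2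
RSS_B(y), this costs (512/n) RSS_B(y) in the residual and, once n ≥ 512, at most a doubling of the
quadratic form in b. -/
theorem exp_mul_normalDensity_ge {A : Matrix (Fin n) ι ℝ} {B : Matrix (Fin n) κ ℝ}
    (hA : LinearIndependent ℝ A.col) (hB : LinearIndependent ℝ B.col)
    (hAB : hatMatrix A * B = B) (hn : 512 ≤ n) {v : ℝ} (hv : 0 < v) (y : Fin n → ℝ) (b : ι → ℝ) :
    (2 * Real.pi * v) ^ (-(n : ℝ) / 2) *
        Real.exp (-((rss A y + 512 / n * rss B y) / (2 * v))) *
        Real.exp (-(1 / v * sqNorm (hatMatrix A *ᵥ y - A *ᵥ b)))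
      ≤ (2 * Real.pi * v) ^ (-(n : ℝ) / 2) * Real.exp (-(1 / (2 * v) * sqNorm (y - A *ᵥ b)))
        * Real.exp (-(128 * (rss B (A *ᵥ b) / (n * v)))) := by
  have hn' : (512 : ℝ) ≤ n := by exact_mod_cast hn
  rw [mul_assoc _ (Real.exp _) (Real.exp _), ← Real.exp_add,
    mul_assoc _ (Real.exp _) (Real.exp _), ← Real.exp_add]
  gcongr ?_ * Real.exp ?_
  have hQ : rss B (A *ᵥ b) ≤ 2 * sqNorm (hatMatrix A *ᵥ y - A *ᵥ b) + 2 * rss B y := by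
    have h1 := sqNorm_add_le ((1 - hatMatrix B) *ᵥ (A *ᵥ b - hatMatrix A *ᵥ y))
      ((1 - hatMatrix B) *ᵥ (hatMatrix A *ᵥ y))
    rw [← Matrix.mulVec_add, sub_add_cancel, ← rss_eq_sqNorm hB (A *ᵥ b),
      ← rss_eq_sqNorm hB (hatMatrix A *ᵥ y), rss_hatMatrix_mulVec hA hB hAB] at h1
    have h2 := (isProj_hatMatrix hB).compl.sqNorm_mulVec_le (A *ᵥ b - hatMatrix A *ᵥ y)
    have h3 : sqNorm (A *ᵥ b - hatMatrix A *ᵥ y) = sqNorm (hatMatrix A *ᵥ y - A *ᵥ b) := by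
      rw [← neg_sub, sqNorm_neg]
    rw [h3] at h2
    linarith [rss_nonneg hA y]
  rw [sqNorm_sub_mulVec hA y b]
  set S := sqNorm (hatMatrix A *ᵥ y - A *ᵥ b)
  have hS : 0 ≤ S := sqNorm_nonneg _
  have h1 : 128 * (rss B (A *ᵥ b) / (n * v)) ≤ 1 / (2 * v) * S + 512 / n * rss B y / (2 * v) := by
    calc 128 * (rss B (A *ᵥ b) / (n * v)) ≤ 128 * ((2 * S + 2 * rss B y) / (n * v)) := by gcongr
      _ = 1 / (2 * v) * (512 / n * S) + 512 / n * rss B y / (2 * v) := by field_simp; ring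
      _ ≤ _ := by
        gcongr
        rw [div_mul_eq_mul_div, div_le_iff₀ (by positivity)]
        nlinarith
  have h2 : 1 / v * S = 1 / (2 * v) * S + 1 / (2 * v) * S := by field_simp; ring
  rw [add_div, h2, mul_add]
  have h3 : 1 / (2 * v) * rss A y = rss A y / (2 * v) := by ring
  rw [h3]
  linarith

/-- Integrating the doubled quadratic form over b gives the factor 2^(-d/2). The imaginary data have
variance nv, so n enters as (n²)^(-h); the Gamma ratio later restores n^h. -/
theorem le_pepMarginal {A : Matrix (Fin n) ι ℝ} {B : Matrix (Fin n) κ ℝ}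
    (hA : LinearIndependent ℝ A.col) (hB : LinearIndependent ℝ B.col)
    (hAB : hatMatrix A * B = B) (hcard : Fintype.card κ ≤ Fintype.card ι)
    (hn : 2 * Fintype.card ι + 4 ≤ n) (hn' : 512 ≤ n) {c c₀ : ℝ} (hc : 0 < c) (hc₀ : 0 < c₀)
    (y : Fin n → ℝ) :
    ENNReal.ofReal (c₀ * predictiveConst B * Real.Gamma (halfDof B) *
        ((1 / 2 * (4 * (n : ℝ) ^ 2) ^ (-(halfDof B - halfDof A)) *
          Real.exp (-(128 * (Fintype.card ι + 1 : ℝ))) * 2 ^ (-(Fintype.card ι : ℝ) / 2))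
            / Real.Gamma (halfDof A))) *
        ENNReal.ofReal (rss A y + 512 / n * rss B y) ^ (-halfDof B)
      ≤ pepMarginal (n : ℝ) c c₀ A A B y := by
  have hcard' : (Fintype.card κ : ℝ) ≤ Fintype.card ι := by exact_mod_cast hcard
  have hnr : 2 * (Fintype.card ι : ℝ) + 4 ≤ n := by exact_mod_cast hn
  have hd0 : (0 : ℝ) ≤ Fintype.card κ := Nat.cast_nonneg _
  have hd : (0 : ℝ) ≤ Fintype.card ι := Nat.cast_nonneg _
  have hn0 : (0 : ℝ) < n := by linarith
  have hsA : 0 < halfDof A := by unfold halfDof; linarith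
  have hsB : 0 < halfDof B := by unfold halfDof; linarith
  have hD := coefMass_pos hA
  have hK := predictiveConst_pos hA hsA
  have hK₀ := predictiveConst_pos hB hsB
  have hΓ := Real.Gamma_pos_of_pos hsA
  have hΓB := Real.Gamma_pos_of_pos hsB
  have hR' : 0 ≤ rss A y + 512 / n * rss B y := by
    have := rss_nonneg hA y
    have := rss_nonneg hB y
    positivity
  obtain ⟨b₁, hb₁⟩ := hatMatrix_mulVec A y
  set h := halfDof B - halfDof A with hh
  set q : ℝ := 1 / 2 * (4 * (n : ℝ) ^ 2) ^ (-h) * Real.exp (-(128 * (Fintype.card ι + 1 : ℝ)))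
    with hq
  have hq0 : 0 < q := by positivity
  have h1 : ∀ v ∈ Set.Ioi (0 : ℝ),
      ENNReal.ofReal (c₀ * predictiveConst B * (q * 2 ^ (-(Fintype.card ι : ℝ) / 2)
          / Real.Gamma (halfDof A))) *
        ENNReal.ofReal (v⁻¹ * (2 * v) ^ (-halfDof B) *
          Real.exp (-((rss A y + 512 / n * rss B y) / (2 * v))))
      ≤ ∫⁻ b : ι → ℝ, normalDensity (A *ᵥ b) v y * pepPrior (n : ℝ) c c₀ A B b v := by
    intro v hv
    have hv' : (0 : ℝ) < v := hv
    have h2v : 0 < 2 * v := by positivity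
    set E := Real.exp (-((rss A y + 512 / n * rss B y) / (2 * v))) with hE
    have hpt : ∀ b : ι → ℝ,
        ENNReal.ofReal (c₀ * predictiveConst B / predictiveConst A / v * (q * (2 * v) ^ (-h)) *
          ((2 * Real.pi * v) ^ (-(n : ℝ) / 2) * E)) *
          ENNReal.ofReal (Real.exp (-(1 / v * sqNorm (hatMatrix A *ᵥ y - A *ᵥ b))))
        ≤ normalDensity (A *ᵥ b) v y * pepPrior (n : ℝ) c c₀ A B b v := by
      intro b
      rw [pepPrior_eq hA hB hsA hsB hn0 hc hc₀ hv']
      refine le_trans ?_ (mul_le_mul_right (mul_le_mul_right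
        (le_lintegral_predictiveRatio hA hB hAB hcard hn b (mul_pos hn0 hv')) _) _)
      rw [normalDensity_eq _ hv', ← ENNReal.ofReal_mul (by positivity),
        ← ENNReal.ofReal_mul (by positivity), ← ENNReal.ofReal_mul (by positivity)]
      refine ENNReal.ofReal_le_ofReal ?_
      have key := exp_mul_normalDensity_ge hA hB hAB hn' hv' y b
      have e1 : 8 * ((n : ℝ) * (n * v)) = (4 * (n : ℝ) ^ 2) * (2 * v) := by ring
      rw [← hh, e1, Real.mul_rpow (by positivity) h2v.le, mul_add, neg_add, Real.exp_add]
      calc _ = c₀ * predictiveConst B / predictiveConst A / v * (q * (2 * v) ^ (-h)) *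
            ((2 * Real.pi * v) ^ (-(n : ℝ) / 2) * E *
              Real.exp (-(1 / v * sqNorm (hatMatrix A *ᵥ y - A *ᵥ b)))) := by ring
        _ ≤ c₀ * predictiveConst B / predictiveConst A / v * (q * (2 * v) ^ (-h)) *
            ((2 * Real.pi * v) ^ (-(n : ℝ) / 2) *
              Real.exp (-(1 / (2 * v) * sqNorm (y - A *ᵥ b)))
                * Real.exp (-(128 * (rss B (A *ᵥ b) / (n * v))))) :=
            mul_le_mul_of_nonneg_left key (by positivity)
        _ = _ := by rw [hq]; ring
    refine le_trans (le_of_eq ?_) (lintegral_mono hpt)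
    rw [lintegral_const_mul' _ _ ENNReal.ofReal_ne_top, hb₁,
      lintegral_exp_neg_mul_sqNorm_sub hA (by positivity), rss_mulVec hA,
      ← ENNReal.ofReal_mul (by positivity), ← ENNReal.ofReal_mul (by positivity)]
    congr 1
    rw [mul_zero, neg_zero, Real.exp_zero, one_mul, one_div, Real.inv_rpow hv'.le,
      ← Real.rpow_neg hv'.le]
    have e2 : (2 * Real.pi * v) ^ (-(n : ℝ) / 2) * v ^ (-(-(Fintype.card ι : ℝ) / 2))
        = Real.pi ^ (-(n : ℝ) / 2) * ((2 * v) ^ (-halfDof A) * 2 ^ (-(Fintype.card ι : ℝ) / 2)) := by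
      have e3 : (2 * v) ^ (-halfDof A)
          = (2 * v) ^ (-(n : ℝ) / 2) * (2 * v) ^ (-(-(Fintype.card ι : ℝ) / 2)) := by
        rw [← Real.rpow_add h2v]; congr 1; unfold halfDof; ring
      rw [show 2 * Real.pi * v = Real.pi * (2 * v) by ring, Real.mul_rpow Real.pi_pos.le h2v.le, e3,
        Real.mul_rpow (y := v) (z := -(-(Fintype.card ι : ℝ) / 2)) zero_le_two hv'.le,
        Real.rpow_neg zero_le_two]
      have : (2 : ℝ) ^ (-(Fintype.card ι : ℝ) / 2) ≠ 0 := by positivity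
      field_simp
    have e4 : (2 * v) ^ (-halfDof B) = (2 * v) ^ (-halfDof A) * (2 * v) ^ (-h) := by
      rw [← Real.rpow_add h2v]; congr 1; rw [hh]; ring
    calc _ = c₀ * predictiveConst B * v⁻¹ * q * E * (2 * v) ^ (-h) *
          (coefMass A * (Real.pi ^ (-(n : ℝ) / 2) *
            ((2 * v) ^ (-halfDof A) * 2 ^ (-(Fintype.card ι : ℝ) / 2))) / predictiveConst A) := by
          rw [e4, predictiveConst.eq_def A]; field_simp
      _ = _ := by rw [← e2]; ring
  refine le_trans (le_of_eq ?_) (setLIntegral_mono' measurableSet_Ioi h1)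
  rw [lintegral_const_mul' _ _ ENNReal.ofReal_ne_top,
    lintegral_inv_mul_rpow_mul_exp hsB hR' two_pos, ← mul_assoc,
    ← ENNReal.ofReal_mul (by positivity)]
  congr 2
  ring

end MarginalBounds

/-! ### Both coefficients are of exact order n^(-h). -/

section CoefficientBounds

theorem upper_coefficient_le {C s h x : ℝ} (hC : 0 < C) (hx : 0 < x) (hh : 0 ≤ h)
    (hs : s ≤ 2 * (s - h)) (hsh : 0 < s - h)
    (h₁ : Real.Gamma (s + h) ≤ C * (s ^ h * Real.Gamma s))
    (h₂ : (s - h) ^ h * Real.Gamma (s - h) ≤ C * Real.Gamma s) :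
    Real.Gamma (s + h) * (x ^ (-h) * Real.Gamma (s - h) / Real.Gamma s ^ 2)
      ≤ C ^ 2 * 2 ^ h * x ^ (-h) := by
  have hs0 : 0 < s := by linarith
  have hΓ := Real.Gamma_pos_of_pos hs0
  have hΓh := Real.Gamma_pos_of_pos hsh
  have h3 : s ^ h * Real.Gamma (s - h) ≤ 2 ^ h * (C * Real.Gamma s) := by
    calc s ^ h * Real.Gamma (s - h) ≤ (2 * (s - h)) ^ h * Real.Gamma (s - h) := by gcongr
      _ = 2 ^ h * ((s - h) ^ h * Real.Gamma (s - h)) := by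
        rw [Real.mul_rpow zero_le_two hsh.le]; ring
      _ ≤ _ := by gcongr
  calc Real.Gamma (s + h) * (x ^ (-h) * Real.Gamma (s - h) / Real.Gamma s ^ 2)
      ≤ C * (s ^ h * Real.Gamma s) * (x ^ (-h) * Real.Gamma (s - h) / Real.Gamma s ^ 2) := by
        gcongr
    _ = C * x ^ (-h) / Real.Gamma s * (s ^ h * Real.Gamma (s - h)) := by field_simp
    _ ≤ C * x ^ (-h) / Real.Gamma s * (2 ^ h * (C * Real.Gamma s)) := by gcongr
    _ = _ := by field_simp

theorem le_lower_coefficient {C s h x r : ℝ} (hC : 0 < C) (hx : 0 < x) (hh : 0 ≤ h)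
    (hs : x / 4 ≤ s) (hr : 0 ≤ r) (h₁ : s ^ h * Real.Gamma s ≤ C * Real.Gamma (s + h)) :
    r * (16 ^ h * C)⁻¹ * x ^ (-h)
      ≤ Real.Gamma (s + h) * (r * (4 * x ^ 2) ^ (-h) / Real.Gamma s) := by
  have hs0 : 0 < s := by linarith
  have hΓ := Real.Gamma_pos_of_pos hs0
  have h2 : (x / 4) ^ h * Real.Gamma s ≤ C * Real.Gamma (s + h) :=
    le_trans (by gcongr) h₁
  have e : (4 * x ^ 2) ^ (-h) * (x / 4) ^ h = (16 ^ h)⁻¹ * x ^ (-h) := by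
    have h16 : (16 : ℝ) ^ h = 4 ^ h * 4 ^ h := by
      rw [← Real.mul_rpow (by norm_num) (by norm_num)]; norm_num
    have hx2 : (x ^ 2) ^ h = x ^ h * x ^ h := by
      rw [← Real.mul_rpow hx.le hx.le, sq]
    rw [Real.rpow_neg (by positivity), Real.rpow_neg hx.le, Real.mul_rpow (by norm_num)
      (by positivity), Real.div_rpow hx.le (by norm_num), hx2, h16]
    have : x ^ h ≠ 0 := by positivity
    have : (4 : ℝ) ^ h ≠ 0 := by positivity
    field_simp
  calc r * (16 ^ h * C)⁻¹ * x ^ (-h)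
      = r * C⁻¹ / Real.Gamma s * (4 * x ^ 2) ^ (-h) * ((x / 4) ^ h * Real.Gamma s) := by
        rw [mul_inv]
        calc _ = r * C⁻¹ * ((16 ^ h)⁻¹ * x ^ (-h)) := by ring
          _ = _ := by rw [← e]; field_simp
    _ ≤ r * C⁻¹ / Real.Gamma s * (4 * x ^ 2) ^ (-h) * (C * Real.Gamma (s + h)) := by gcongr
    _ = _ := by field_simp

/-- Two-sided bound of the marginal likelihood by powers of residual sums of squares, with a
factor `n ^ (-k / 2)` penalizing the `k` columns in excess of those of the reference design. -/
theorem exists_pepMarginal_bounds (ι κ : Type*) [Fintype ι] [DecidableEq ι] [Fintype κ]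
    [DecidableEq κ] (hcard : Fintype.card κ ≤ Fintype.card ι) :
    ∃ C : ℝ, 0 < C ∧ ∀ (n : ℕ), 512 + 4 * Fintype.card ι ≤ n →
      ∀ (A : Matrix (Fin n) ι ℝ) (B : Matrix (Fin n) κ ℝ), LinearIndependent ℝ A.col →
      LinearIndependent ℝ B.col → hatMatrix A * B = B → ∀ (c c₀ : ℝ), 0 < c → 0 < c₀ →
      ∀ y : Fin n → ℝ,
      pepMarginal (n : ℝ) c c₀ A A B y ≤
        ENNReal.ofReal (c₀ * predictiveConst B *
          (C * (n : ℝ) ^ (-(((Fintype.card ι - Fintype.card κ : ℕ) : ℝ) / 2)))) *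
          ENNReal.ofReal (rss A y) ^ (-halfDof B) ∧
      ENNReal.ofReal (c₀ * predictiveConst B *
          (C⁻¹ * (n : ℝ) ^ (-(((Fintype.card ι - Fintype.card κ : ℕ) : ℝ) / 2)))) *
          ENNReal.ofReal (rss A y + 512 / n * rss B y) ^ (-halfDof B) ≤
        pepMarginal (n : ℝ) c c₀ A A B y := by
  obtain ⟨C, hC, hΓ⟩ := exists_Gamma_ratio_bound (Fintype.card ι - Fintype.card κ)
  set h : ℝ := ((Fintype.card ι - Fintype.card κ : ℕ) : ℝ) / 2 with hh
  have hh0 : 0 ≤ h := by positivity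
  set r : ℝ := 1 / 2 * Real.exp (-(128 * (Fintype.card ι + 1 : ℝ)))
    * 2 ^ (-(Fintype.card ι : ℝ) / 2) with hr
  have hr0 : 0 < r := by positivity
  set L : ℝ := r * (16 ^ h * C)⁻¹ with hL
  have hL0 : 0 < L := by positivity
  -- One constant serves as factor above and, inverted, below; adding L⁻¹ makes its inverse at most
  -- L.
  refine ⟨C ^ 2 * 2 ^ h + L⁻¹, by positivity, fun n hn A B hA hB hAB c c₀ hc hc₀ y => ?_⟩
  have hnr : 512 + 4 * (Fintype.card ι : ℝ) ≤ n := by exact_mod_cast hn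
  have hn0 : (0 : ℝ) < n := by
    have : (0 : ℝ) ≤ Fintype.card ι := Nat.cast_nonneg _
    linarith
  have hhd : 2 * h ≤ Fintype.card ι := by
    rw [hh, mul_div_cancel₀ _ two_ne_zero]; exact_mod_cast Nat.sub_le _ _
  have hd : (0 : ℝ) ≤ Fintype.card ι := Nat.cast_nonneg _
  have hdof : halfDof B - halfDof A = h := halfDof_sub_halfDof A B hcard
  have hs : halfDof A = ((n : ℝ) - Fintype.card ι) / 2 := rfl
  have hsB : halfDof B = halfDof A + h := by linarith
  have hs1 : 1 ≤ halfDof A - h := by linarith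
  have hsA : 0 < halfDof A := by linarith
  have hK₀ := predictiveConst_pos hB (show 0 < halfDof B by linarith)
  obtain ⟨g1, g2⟩ := hΓ (halfDof A) (by linarith)
  obtain ⟨-, g3⟩ := hΓ (halfDof A - h) hs1
  rw [sub_add_cancel] at g3
  constructor
  · refine (pepMarginal_le hA hB hAB (by linarith) (by linarith) hn0 hc hc₀ y).trans ?_
    gcongr ENNReal.ofReal ?_ * _
    rw [mul_assoc (c₀ * predictiveConst B), hdof]
    refine mul_le_mul_of_nonneg_left ?_ (by positivity)
    rw [hsB]
    refine (upper_coefficient_le hC hn0 hh0 (by linarith) (by linarith) g1 g3).trans ?_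
    gcongr
    linarith [inv_pos.2 hL0]
  · refine le_trans ?_ (le_pepMarginal hA hB hAB hcard (by omega) (by omega) hc hc₀ y)
    gcongr ENNReal.ofReal ?_ * _
    rw [mul_assoc (c₀ * predictiveConst B), hdof]
    refine mul_le_mul_of_nonneg_left ?_ (by positivity)
    rw [hsB]
    have key := le_lower_coefficient (r := r) hC hn0 hh0
      (show (n : ℝ) / 4 ≤ halfDof A by linarith) hr0.le g2
    refine le_trans ?_ (key.trans_eq ?_)
    · rw [← hL]
      gcongr
      refine inv_le_of_inv_le₀ hL0 ?_
      have : 0 ≤ C ^ 2 * 2 ^ h := by positivity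
      linarith
    · rw [hr]; ring

end CoefficientBounds

/-! ### Bound of the Bayes factor by residual sums of squares. -/

section BayesFactor

/-- The perturbation costs (1 + 512R₀/(xS))^s ≤ exp(512 s R₀/(xS)), and s ≤ x/2 makes the exponent
at most 256 R₀/S. -/
theorem bayesFactor_ratio_le {CU CT G a b R S R₀ s x : ℝ} (hCU : 0 < CU) (hCT : 0 < CT)
    (hG : 0 < G) (hx : 0 < x) (hR : 0 < R) (hS : 0 < S) (hR₀ : 0 ≤ R₀) (hs : 0 ≤ s)
    (hsx : s ≤ x / 2) :
    ENNReal.ofReal (G * (CU * x ^ a)) * ENNReal.ofReal R ^ (-s) /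
      (ENNReal.ofReal (G * (CT⁻¹ * x ^ b)) * ENNReal.ofReal (S + 512 / x * R₀) ^ (-s))
      ≤ ENNReal.ofReal (CU * CT * x ^ (a - b) * (S / R) ^ s * Real.exp (256 * (R₀ / S))) := by
  have hS' : 0 < S + 512 / x * R₀ := by positivity
  rw [ENNReal.ofReal_rpow_of_pos hR, ENNReal.ofReal_rpow_of_pos hS',
    ← ENNReal.ofReal_mul (by positivity), ← ENNReal.ofReal_mul (by positivity),
    ← ENNReal.ofReal_div_of_pos (by positivity)]
  refine ENNReal.ofReal_le_ofReal ?_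
  have h1 : (S + 512 / x * R₀) ^ s ≤ S ^ s * Real.exp (256 * (R₀ / S)) := by
    have e : S + 512 / x * R₀ = S * (1 + 512 / x * (R₀ / S)) := by field_simp
    rw [e, Real.mul_rpow hS.le (by positivity)]
    gcongr
    calc (1 + 512 / x * (R₀ / S)) ^ s ≤ Real.exp (512 / x * (R₀ / S)) ^ s := by
          gcongr
          linarith [Real.add_one_le_exp (512 / x * (R₀ / S))]
      _ = Real.exp (512 / x * (R₀ / S) * s) := by rw [← Real.exp_mul]
      _ ≤ _ := by
        refine Real.exp_le_exp.2 ?_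
        calc 512 / x * (R₀ / S) * s ≤ 512 / x * (R₀ / S) * (x / 2) := by gcongr
          _ = _ := by field_simp; ring
  rw [Real.rpow_neg hR.le, Real.rpow_neg hS'.le, Real.rpow_sub hx, Real.div_rpow hS.le hR.le]
  have hRs : 0 < R ^ s := by positivity
  have hSs : 0 < (S + 512 / x * R₀) ^ s := by positivity
  calc G * (CU * x ^ a) * (R ^ s)⁻¹ / (G * (CT⁻¹ * x ^ b) * ((S + 512 / x * R₀) ^ s)⁻¹)
      = CU * CT * (x ^ a / x ^ b) / R ^ s * (S + 512 / x * R₀) ^ s := by field_simp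
    _ ≤ CU * CT * (x ^ a / x ^ b) / R ^ s * (S ^ s * Real.exp (256 * (R₀ / S))) := by gcongr
    _ = _ := by ring

variable {p : ℕ}

theorem exists_marginal_bounds {M₀ γ : Finset (Fin p)} (h : M₀ ⊆ γ) :
    ∃ C : ℝ, 0 < C ∧ ∀ (n : ℕ), 512 + 4 * γ.card ≤ n → ∀ (X : Matrix (Fin n) (Fin p) ℝ),
      LinearIndependent ℝ (design X γ).col → ∀ c : Finset (Fin p) → ℝ, (∀ γ, 0 < c γ) →
      ∀ y : Fin n → ℝ,
      marginal c X M₀ γ y ≤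
        ENNReal.ofReal (c M₀ * predictiveConst (design X M₀) *
          (C * (n : ℝ) ^ (-(((γ.card : ℝ) - M₀.card) / 2)))) *
          ENNReal.ofReal (rss (design X γ) y) ^ (-halfDof (design X M₀)) ∧
      ENNReal.ofReal (c M₀ * predictiveConst (design X M₀) *
          (C⁻¹ * (n : ℝ) ^ (-(((γ.card : ℝ) - M₀.card) / 2)))) *
          ENNReal.ofReal (rss (design X γ) y + 512 / n * rss (design X M₀) y)
            ^ (-halfDof (design X M₀)) ≤
        marginal c X M₀ γ y := by
  have hcard : Fintype.card M₀ ≤ Fintype.card γ := by simpa using Finset.card_le_card h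
  obtain ⟨C, hC, hb⟩ := exists_pepMarginal_bounds γ M₀ hcard
  refine ⟨C, hC, fun n hn X hX c hc y => ?_⟩
  have := hb n (by simpa using hn) (design X γ) (design X M₀) hX
    (linearIndependent_design_of_subset h hX) (hatMatrix_mul_design h hX) (c γ) (c M₀) (hc _)
    (hc _) y
  rw [Nat.cast_sub hcard] at this
  simp only [Fintype.card_coe] at this
  exact this

theorem halfDof_design {n : ℕ} (X : Matrix (Fin n) (Fin p) ℝ) (γ : Finset (Fin p)) :
    halfDof (design X γ) = ((n : ℝ) - γ.card) / 2 := by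
  simp [halfDof]

theorem exists_bayesFactor_le {M₀ j T : Finset (Fin p)} (hj : M₀ ⊆ j) (hT : M₀ ⊆ T) :
    ∃ K : ℝ, 0 < K ∧ ∀ (n : ℕ), 512 + 4 * j.card + 4 * T.card ≤ n →
      ∀ (X : Matrix (Fin n) (Fin p) ℝ), LinearIndependent ℝ (design X j).col →
      LinearIndependent ℝ (design X T).col → ∀ c : Finset (Fin p) → ℝ, (∀ γ, 0 < c γ) →
      ∀ y : Fin n → ℝ, 0 < rss (design X j) y → 0 < rss (design X T) y →
      bayesFactor c X M₀ j T y ≤ ENNReal.ofReal (K * (n : ℝ) ^ (((T.card : ℝ) - j.card) / 2) *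
        (rss (design X T) y / rss (design X j) y) ^ (((n : ℝ) - M₀.card) / 2) *
        Real.exp (256 * (rss (design X M₀) y / rss (design X T) y))) := by
  obtain ⟨CU, hCU, hU⟩ := exists_marginal_bounds hj
  obtain ⟨CT, hCT, hL⟩ := exists_marginal_bounds hT
  refine ⟨CU * CT, by positivity, fun n hn X hXj hXT c hc y hRj hRT => ?_⟩
  have hX₀ := linearIndependent_design_of_subset hT hXT
  have hM₀ : (M₀.card : ℝ) ≤ T.card := by exact_mod_cast Finset.card_le_card hT
  have hnr : 512 + 4 * (j.card : ℝ) + 4 * T.card ≤ n := by exact_mod_cast hn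
  have hj0 : (0 : ℝ) ≤ j.card := Nat.cast_nonneg _
  have hM0 : (0 : ℝ) ≤ M₀.card := Nat.cast_nonneg _
  have hs : 0 < halfDof (design X M₀) := by rw [halfDof_design]; linarith
  have hG : 0 < c M₀ * predictiveConst (design X M₀) :=
    mul_pos (hc _) (predictiveConst_pos hX₀ hs)
  have hn0 : (0 : ℝ) < n := by linarith
  refine (ENNReal.div_le_div (hU n (by omega) X hXj c hc y).1
    (hL n (by omega) X hXT c hc y).2).trans ?_
  refine (bayesFactor_ratio_le hCU hCT hG hn0 hRj hRT (rss_nonneg hX₀ y) hs.le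
    (by rw [halfDof_design]; linarith)).trans_eq ?_
  rw [halfDof_design]
  congr 5
  ring

theorem marginal_ne_zero_ne_top {M₀ T : Finset (Fin p)} (hT : M₀ ⊆ T) {n : ℕ}
    (hn : 512 + 4 * T.card ≤ n) {X : Matrix (Fin n) (Fin p) ℝ}
    (hX : LinearIndependent ℝ (design X T).col) {c : Finset (Fin p) → ℝ} (hc : ∀ γ, 0 < c γ)
    {y : Fin n → ℝ} (hy : 0 < rss (design X T) y) :
    marginal c X M₀ T y ≠ 0 ∧ marginal c X M₀ T y ≠ ∞ := by
  obtain ⟨C, hC, hb⟩ := exists_marginal_bounds hT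
  have hX₀ := linearIndependent_design_of_subset hT hX
  have hM₀ : (M₀.card : ℝ) ≤ T.card := by exact_mod_cast Finset.card_le_card hT
  have hnr : 512 + 4 * (T.card : ℝ) ≤ n := by exact_mod_cast hn
  have hM0 : (0 : ℝ) ≤ M₀.card := Nat.cast_nonneg _
  have hs : 0 < halfDof (design X M₀) := by rw [halfDof_design]; linarith
  have hG : 0 < c M₀ * predictiveConst (design X M₀) :=
    mul_pos (hc _) (predictiveConst_pos hX₀ hs)
  have hn0 : (0 : ℝ) < n := by linarith
  obtain ⟨h1, h2⟩ := hb n hn X hX c hc y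
  have hS : 0 < rss (design X T) y + 512 / n * rss (design X M₀) y := by
    have := rss_nonneg hX₀ y
    positivity
  rw [ENNReal.ofReal_rpow_of_pos hy, ← ENNReal.ofReal_mul (by positivity)] at h1
  rw [ENNReal.ofReal_rpow_of_pos hS, ← ENNReal.ofReal_mul (by positivity)] at h2
  exact ⟨((ENNReal.ofReal_pos.2 (by positivity)).trans_le h2).ne',
    ne_top_of_le_ne_top ENNReal.ofReal_ne_top h1⟩

end BayesFactor

/-! ### Deterministic bounds in the nested and the non-nested case. -/

section RealBounds

/-- RT/Rj ≤ 1 + C/Rj ≤ exp(C²/n), so its power of order n/2 stays bounded; at least one superfluous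
column gives n^(-1/2). -/
theorem nested_bound {K n dT dj d₀ C M RT Rj R₀ : ℝ} (hK : 0 < K) (hn : 1 ≤ n) (hC : 0 < C)
    (hM : 0 < M) (hd : dT + 1 ≤ dj) (hd₀ : 0 ≤ d₀) (hd₀n : d₀ ≤ n) (hRT : 0 < RT) (hRj : 0 < Rj)
    (h₁ : RT - Rj ≤ C) (h₂ : n ≤ C * Rj) (h₃ : n ≤ C * RT) (h₄ : R₀ ≤ M * n) :
    K * n ^ ((dT - dj) / 2) * (RT / Rj) ^ ((n - d₀) / 2) * Real.exp (256 * (R₀ / RT))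
      ≤ K * n ^ (-(1 / 2) : ℝ) * Real.exp (C ^ 2 / 2) * Real.exp (256 * (M * C)) := by
  have hn0 : 0 < n := by linarith
  have e1 : n ^ ((dT - dj) / 2) ≤ n ^ (-(1 / 2) : ℝ) :=
    Real.rpow_le_rpow_of_exponent_le hn (by linarith)
  have e2 : (RT / Rj) ^ ((n - d₀) / 2) ≤ Real.exp (C ^ 2 / 2) := by
    have h5 : RT / Rj ≤ Real.exp (C ^ 2 / n) := by
      refine le_trans ?_ (Real.add_one_le_exp _)
      rw [div_le_iff₀ hRj, add_mul, one_mul]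
      have : C ≤ C ^ 2 / n * Rj := by
        rw [div_mul_eq_mul_div, le_div_iff₀ hn0]; nlinarith
      linarith
    calc (RT / Rj) ^ ((n - d₀) / 2) ≤ Real.exp (C ^ 2 / n) ^ ((n - d₀) / 2) :=
          Real.rpow_le_rpow (by positivity) h5 (by linarith)
      _ = Real.exp (C ^ 2 / n * ((n - d₀) / 2)) := by rw [← Real.exp_mul]
      _ ≤ _ := by
        refine Real.exp_le_exp.2 ?_
        calc C ^ 2 / n * ((n - d₀) / 2) ≤ C ^ 2 / n * (n / 2) := by gcongr; linarith
          _ = _ := by field_simp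
  have e3 : R₀ / RT ≤ M * C := by
    rw [div_le_iff₀ hRT]; nlinarith
  gcongr

/-- Since e ≤ Cn, a surplus nb/2 over e pushes RT/Rj below the fixed ratio C/(C + b/2) < 1. Here e
stands for the squared length of the errors. -/
theorem nonnested_bound {K n dT dj d₀ C M b e RT Rj R₀ : ℝ} (hK : 0 < K) (hn : 1 ≤ n)
    (hC : 0 < C) (hM : 0 < M) (hb : 0 < b) (hdT : 0 ≤ dT) (hdj : 0 ≤ dj) (hd₀n : d₀ ≤ n)
    (hRT : 0 < RT) (h₁ : RT ≤ e) (h₂ : e ≤ C * n)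
    (h₃ : e + n * b / 2 ≤ Rj) (h₄ : n ≤ C * RT) (h₅ : R₀ ≤ M * n) :
    K * n ^ ((dT - dj) / 2) * (RT / Rj) ^ ((n - d₀) / 2) * Real.exp (256 * (R₀ / RT))
      ≤ K * n ^ dT * (C / (C + b / 2)) ^ ((n - d₀) / 2) * Real.exp (256 * (M * C)) := by
  have hn0 : 0 < n := by linarith
  have e1 : n ^ ((dT - dj) / 2) ≤ n ^ dT :=
    Real.rpow_le_rpow_of_exponent_le hn (by linarith)
  have hRj : 0 < Rj := by
    have : 0 < n * b / 2 := by positivity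
    linarith
  have e2 : RT / Rj ≤ C / (C + b / 2) := by
    rw [div_le_div_iff₀ hRj (by positivity)]
    calc RT * (C + b / 2) ≤ e * (C + b / 2) := by gcongr
      _ = C * e + e * (b / 2) := by ring
      _ ≤ C * e + C * n * (b / 2) := by gcongr
      _ = C * (e + n * b / 2) := by ring
      _ ≤ C * Rj := by gcongr
  have e3 : R₀ / RT ≤ M * C := by
    rw [div_le_iff₀ hRT]; nlinarith
  have : 0 ≤ (n - d₀) / 2 := by linarith
  gcongr

theorem tendsto_rpow_mul_rpow_half_zero {ρ : ℝ} (h0 : 0 < ρ) (h1 : ρ < 1) (k : ℕ) (d₀ : ℝ) :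
    Tendsto (fun n : ℕ => (n : ℝ) ^ (k : ℝ) * ρ ^ (((n : ℝ) - d₀) / 2)) atTop (𝓝 0) := by
  have hs : |Real.sqrt ρ| < 1 := by
    rw [abs_of_nonneg (Real.sqrt_nonneg _), Real.sqrt_lt' one_pos]; simpa using h1
  have h := (tendsto_pow_const_mul_const_pow_of_abs_lt_one k hs).mul_const (ρ ^ (-d₀ / 2))
  rw [zero_mul] at h
  refine h.congr fun n => ?_
  rw [Real.rpow_natCast, mul_assoc, Real.sqrt_eq_rpow, ← Real.rpow_natCast (ρ ^ (1 / 2 : ℝ)),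
    ← Real.rpow_mul h0.le, ← Real.rpow_add h0]
  congr 2; ring

end RealBounds

/-! ### Markov's inequality and moments under the true model. -/

section Probability

/-- Off an event of probability at most ε the control statistic h is at most C₀/ε, and there Z is
bounded by a null sequence. Only h has to be measurable, not Z. -/
theorem tendstoInProb_zero_of_lintegral_le {P : (n : ℕ) → Measure (Fin n → ℝ)}
    {Z h : (n : ℕ) → (Fin n → ℝ) → ℝ≥0∞} (hm : ∀ n, Measurable (h n)) {C₀ : ℝ} (hC₀ : 0 < C₀)
    (hP : ∀ᶠ n in atTop, ∫⁻ y, h n y ∂P n ≤ ENNReal.ofReal C₀)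
    (hZ : ∀ C : ℝ, 0 < C → ∃ b : ℕ → ℝ, Tendsto b atTop (𝓝 0) ∧
      ∀ᶠ n in atTop, ∀ y, h n y ≤ ENNReal.ofReal C → Z n y ≤ ENNReal.ofReal (b n)) :
    TendstoInProb P Z 0 := by
  intro U hU
  obtain ⟨a, ha, haU⟩ := ENNReal.nhds_zero_basis.mem_iff.1 hU
  rw [ENNReal.tendsto_nhds_zero]
  intro ε hε
  rcases eq_or_ne ε ∞ with rfl | hε'
  · exact Eventually.of_forall fun _ => le_top
  have he : 0 < ε.toReal := ENNReal.toReal_pos hε.ne' hε'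
  obtain ⟨b, hb, hbZ⟩ := hZ (C₀ / ε.toReal) (by positivity)
  have hb' : Tendsto (fun n => ENNReal.ofReal (b n)) atTop (𝓝 0) := by
    simpa using ENNReal.tendsto_ofReal hb
  filter_upwards [hP, hbZ, hb'.eventually_lt_const ha] with n h1 h2 h3
  have hC : ENNReal.ofReal (C₀ / ε.toReal) ≠ 0 := (ENNReal.ofReal_pos.2 (by positivity)).ne'
  calc P n {y | Z n y ∉ U} ≤ P n {y | ENNReal.ofReal (C₀ / ε.toReal) ≤ h n y} := by
        refine measure_mono fun y hy => ?_
        by_contra hlt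
        exact hy (haU ((h2 y (not_le.1 hlt).le).trans_lt h3))
    _ ≤ (∫⁻ y, h n y ∂P n) / ENNReal.ofReal (C₀ / ε.toReal) :=
        meas_ge_le_lintegral_div (hm n).aemeasurable hC ENNReal.ofReal_ne_top
    _ ≤ ENNReal.ofReal C₀ / ENNReal.ofReal (C₀ / ε.toReal) := by gcongr
    _ = ε := by
        rw [← ENNReal.ofReal_div_of_pos (by positivity), div_div_cancel₀ hC₀.ne',
          ENNReal.ofReal_toReal hε']

/-- This lemma and the next read real inequalities off a bound on a single summand of the control
statistic. -/
theorem le_mul_of_ofReal_inv_mul_le {x q C : ℝ} (hx : 0 < x) (hC : 0 < C)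
    (h : ENNReal.ofReal x⁻¹ * ENNReal.ofReal q ≤ ENNReal.ofReal C) : q ≤ C * x := by
  rw [← ENNReal.ofReal_mul (by positivity), ENNReal.ofReal_le_ofReal_iff hC.le] at h
  rwa [inv_mul_le_iff₀ hx, mul_comm] at h

theorem pos_and_le_mul_of_ofReal_mul_inv_le {x R C : ℝ} (hx : 0 < x) (hC : 0 < C) (hR : 0 ≤ R)
    (h : ENNReal.ofReal x * (ENNReal.ofReal R)⁻¹ ≤ ENNReal.ofReal C) : 0 < R ∧ x ≤ C * R := by
  rcases hR.eq_or_lt with rfl | hR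
  · rw [ENNReal.ofReal_zero, ENNReal.inv_zero,
      ENNReal.mul_top (ENNReal.ofReal_pos.2 hx).ne'] at h
    exact absurd h (by simp)
  · rw [← ENNReal.ofReal_inv_of_pos hR, ← ENNReal.ofReal_mul hx.le,
      ENNReal.ofReal_le_ofReal_iff hC.le, ← div_eq_mul_inv, div_le_iff₀ hR] at h
    exact ⟨hR, h⟩

variable {n p : ℕ} {X : Matrix (Fin n) (Fin p) ℝ} {T : Finset (Fin p)} {β : T → ℝ} {v : ℝ≥0}

theorem lintegral_dataLaw_sqNorm :
    ∫⁻ y, ENNReal.ofReal (sqNorm (y - design X T *ᵥ β)) ∂dataLaw X T β v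
      = ENNReal.ofReal (v * n) := by
  have h := lintegral_pi_gaussianReal_quadratic (design X T *ᵥ β) v 1 fun x => by
    rw [Matrix.one_mulVec]; exact sqNorm_nonneg x
  simp_rw [Matrix.one_mulVec] at h
  rw [Matrix.trace_one, Fintype.card_fin] at h
  exact h

theorem lintegral_dataLaw_sqNorm_mulVec {P : Matrix (Fin n) (Fin n) ℝ} (hP : IsProj P) :
    ∫⁻ y, ENNReal.ofReal (sqNorm (P *ᵥ (y - design X T *ᵥ β))) ∂dataLaw X T β v
      = ENNReal.ofReal (v * P.trace) := by
  simp_rw [hP.sqNorm_mulVec]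
  exact lintegral_pi_gaussianReal_quadratic (design X T *ᵥ β) v P hP.quadratic_nonneg

theorem lintegral_dataLaw_dotProduct_sq (a : Fin n → ℝ) :
    ∫⁻ y, ENNReal.ofReal ((a ⬝ᵥ (y - design X T *ᵥ β)) ^ 2) ∂dataLaw X T β v
      = ENNReal.ofReal (v * sqNorm a) := by
  have e : ∀ x : Fin n → ℝ, x ⬝ᵥ (Matrix.vecMulVec a a *ᵥ x) = (a ⬝ᵥ x) ^ 2 := by
    intro x
    rw [Matrix.vecMulVec_mulVec, dotProduct_comm]
    simp [sq, dotProduct_comm]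
  have h := lintegral_pi_gaussianReal_quadratic (design X T *ᵥ β) v (Matrix.vecMulVec a a)
    fun x => by rw [e]; exact sq_nonneg _
  simp_rw [e] at h
  rw [Matrix.trace_vecMulVec] at h
  exact h

theorem lintegral_dataLaw_inv_rss {γ : Finset (Fin p)} (hv : 0 < v)
    (hγ : LinearIndependent ℝ (design X γ).col) (hTγ : T ⊆ γ)
    (hn : 2 * γ.card + 4 ≤ n) :
    ∫⁻ y, ENNReal.ofReal n * (ENNReal.ofReal (rss (design X γ) y))⁻¹ ∂dataLaw X T β v
      ≤ ENNReal.ofReal (2 / v) := by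
  have hv' : (0 : ℝ) < v := hv
  have hnr : 2 * (γ.card : ℝ) + 4 ≤ n := by exact_mod_cast hn
  have hs : (n : ℝ) / 4 ≤ halfDof (design X γ) - 1 := by rw [halfDof_design]; linarith
  have hn0 : (0 : ℝ) < n := by
    have : (0 : ℝ) ≤ γ.card := Nat.cast_nonneg _
    linarith
  obtain ⟨b, hb⟩ : ∃ b, design X T *ᵥ β = design X γ *ᵥ b := by
    rw [design_mul_selection X hTγ]
    exact ⟨_, (Matrix.mulVec_mulVec _ _ _).symm⟩
  have hm : Measurable fun y : Fin n → ℝ => (ENNReal.ofReal (rss (design X γ) y))⁻¹ :=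
    (continuous_rss _).measurable.ennreal_ofReal.inv
  rw [lintegral_const_mul' _ _ ENNReal.ofReal_ne_top, dataLaw, hb,
    lintegral_pi_gaussianReal _ hv hm,
    lintegral_normalDensity_mul_inv_rss hγ b hv' (by linarith), ← ENNReal.ofReal_mul hn0.le]
  refine ENNReal.ofReal_le_ofReal ?_
  have h1 : 0 < halfDof (design X γ) - 1 := by linarith
  rw [mul_one_div, div_le_div_iff₀ (by positivity) hv']
  nlinarith

/-- The true mean lies in both column spaces, so its residual vanishes and only the trace term
remains. -/
theorem lintegral_dataLaw_rss_sub_le {γ : Finset (Fin p)} (hv : 0 < v)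
    (hγ : LinearIndependent ℝ (design X γ).col) (hTγ : T ⊆ γ) :
    ∫⁻ y, ENNReal.ofReal (rss (design X T) y - rss (design X γ) y) ∂dataLaw X T β v
      ≤ ENNReal.ofReal (2 * (v * γ.card)) := by
  have hv' : (0 : ℝ) < v := hv
  have hT := linearIndependent_design_of_subset hTγ hγ
  obtain ⟨b, hb⟩ : ∃ b, design X T *ᵥ β = design X γ *ᵥ b := by
    rw [design_mul_selection X hTγ]
    exact ⟨_, (Matrix.mulVec_mulVec _ _ _).symm⟩
  have h0 : rss (design X T) (design X γ *ᵥ b) = 0 := by rw [← hb, rss_mulVec hT]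
  have hm : Measurable fun y : Fin n → ℝ =>
      ENNReal.ofReal (rss (design X T) y - rss (design X γ) y) :=
    ((continuous_rss _).sub (continuous_rss _)).measurable.ennreal_ofReal
  rw [dataLaw, hb, lintegral_pi_gaussianReal _ hv hm]
  refine (lintegral_normalDensity_rss_sub_le hγ hT (hatMatrix_mul_design hTγ hγ) b hv').trans ?_
  rw [h0, mul_zero, add_zero, Fintype.card_coe, Fintype.card_coe]
  refine ENNReal.ofReal_le_ofReal ?_
  have : (0 : ℝ) ≤ T.card := Nat.cast_nonneg _
  gcongr
  linarith

theorem dotProduct_gapMatrix_mulVec (γ : Finset (Fin p)) (β : T → ℝ) :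
    β ⬝ᵥ (gapMatrix X T γ *ᵥ β) = (n : ℝ)⁻¹ * rss (design X γ) (design X T *ᵥ β) := by
  rw [gapMatrix, Matrix.smul_mulVec, dotProduct_smul, smul_eq_mul, rss, ← Matrix.mulVec_mulVec,
    ← Matrix.mulVec_mulVec, Matrix.dotProduct_transpose_mulVec, dotProduct_comm]

theorem rss_add_le {γ : Finset (Fin p)} (hγ : LinearIndependent ℝ (design X γ).col)
    (x y : Fin n → ℝ) :
    rss (design X γ) y ≤ 2 * sqNorm (y - x) + 2 * rss (design X γ) x := by
  have h := sqNorm_add_le ((1 - hatMatrix (design X γ)) *ᵥ (y - x))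
    ((1 - hatMatrix (design X γ)) *ᵥ x)
  rw [← Matrix.mulVec_add, sub_add_cancel, ← rss_eq_sqNorm hγ y, ← rss_eq_sqNorm hγ x] at h
  linarith [(isProj_hatMatrix hγ).compl.sqNorm_mulVec_le (y - x)]

/-- Used when T is not nested in γ: the first term is of order n, the cross term of order √n, and
the last one is bounded in probability. -/
theorem rss_expand {γ : Finset (Fin p)} (hγ : LinearIndependent ℝ (design X γ).col)
    (x y : Fin n → ℝ) :
    rss (design X γ) y = rss (design X γ) x
      + 2 * (((1 - hatMatrix (design X γ)) *ᵥ x) ⬝ᵥ (y - x))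
      + sqNorm (y - x) - sqNorm (hatMatrix (design X γ) *ᵥ (y - x)) := by
  have hP := isProj_hatMatrix hγ
  have h := sqNorm_add ((1 - hatMatrix (design X γ)) *ᵥ x)
    ((1 - hatMatrix (design X γ)) *ᵥ (y - x))
  have h2 := IsProj.quadratic_add_compl (hatMatrix (design X γ)) (y - x)
  rw [← hP.sqNorm_mulVec, ← hP.compl.sqNorm_mulVec] at h2
  rw [← Matrix.mulVec_add, add_sub_cancel, ← rss_eq_sqNorm hγ y, ← rss_eq_sqNorm hγ x,
    hP.compl.dotProduct_mulVec, ← Matrix.dotProduct_transpose_mulVec, hP.compl.symm,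
    dotProduct_comm (y - x)] at h
  linarith

end Probability

/-! ### Consistency of Bayes factors and of the posterior probability. -/

section Consistency

variable {p : ℕ} {X : (n : ℕ) → Matrix (Fin n) (Fin p) ℝ} {M₀ j T : Finset (Fin p)} {β : T → ℝ}
  {v : ℝ≥0} {c : Finset (Fin p) → ℝ}

theorem tendsto_rss_of_tendsto_gapMatrix {γ : Finset (Fin p)} {S : Matrix T T ℝ}
    (h : Tendsto (fun n => gapMatrix (X n) T γ) atTop (𝓝 S)) :
    Tendsto (fun n : ℕ => (n : ℝ)⁻¹ * rss (design (X n) γ) (design (X n) T *ᵥ β)) atTop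
      (𝓝 (β ⬝ᵥ (S *ᵥ β))) := by
  have hc : Continuous fun S : Matrix T T ℝ => β ⬝ᵥ (S *ᵥ β) :=
    continuous_const.dotProduct (continuous_id.matrix_mulVec continuous_const)
  refine ((hc.tendsto S).comp h).congr fun n => ?_
  exact dotProduct_gapMatrix_mulVec γ β

theorem exists_rss_le_mul {γ : Finset (Fin p)} {S : Matrix T T ℝ}
    (h : Tendsto (fun n => gapMatrix (X n) T γ) atTop (𝓝 S)) :
    ∃ M : ℝ, 0 < M ∧ ∀ᶠ n : ℕ in atTop,
      rss (design (X n) γ) (design (X n) T *ᵥ β) ≤ M * n := by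
  refine ⟨|β ⬝ᵥ (S *ᵥ β)| + 1, by positivity, ?_⟩
  have hlt : β ⬝ᵥ (S *ᵥ β) < |β ⬝ᵥ (S *ᵥ β)| + 1 := by linarith [le_abs_self (β ⬝ᵥ (S *ᵥ β))]
  filter_upwards [(tendsto_rss_of_tendsto_gapMatrix h).eventually_lt_const hlt,
    eventually_gt_atTop 0] with n hn hn0
  have hn0' : (0 : ℝ) < n := by exact_mod_cast hn0
  rw [inv_mul_lt_iff₀ hn0'] at hn
  linarith

theorem measurable_ofReal_sqNorm_mulVec {n : ℕ} (P : Matrix (Fin n) (Fin n) ℝ)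
    (μ : Fin n → ℝ) : Measurable fun y : Fin n → ℝ => ENNReal.ofReal (sqNorm (P *ᵥ (y - μ))) :=
  ((continuous_sqNorm_mulVec P).comp
    (continuous_id.sub continuous_const)).measurable.ennreal_ofReal

theorem measurable_ofReal_sqNorm_sub {n : ℕ} (μ : Fin n → ℝ) :
    Measurable fun y : Fin n → ℝ => ENNReal.ofReal (sqNorm (y - μ)) :=
  (continuous_sqNorm.comp (continuous_id.sub continuous_const)).measurable.ennreal_ofReal

theorem measurable_ofReal_rss {n : ℕ} {ι : Type*} [Fintype ι] [DecidableEq ι]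
    (A : Matrix (Fin n) ι ℝ) : Measurable fun y : Fin n → ℝ => ENNReal.ofReal (rss A y) :=
  (continuous_rss A).measurable.ennreal_ofReal

theorem tendstoInProb_bayesFactor_of_nested (hM₀T : M₀ ⊆ T) (hTj : T ⊂ j)
    (hrank : ∀ᶠ n in atTop, LinearIndependent ℝ (design (X n) j).col)
    (hc : ∀ γ, 0 < c γ) (hv : 0 < v)
    (hS₀ : ∃ S₀ : Matrix T T ℝ, Tendsto (fun n => gapMatrix (X n) T M₀) atTop (𝓝 S₀)) :
    TendstoInProb (fun n => dataLaw (X n) T β v) (fun n => bayesFactor c (X n) M₀ j T) 0 := by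
  have hv' : (0 : ℝ) < v := hv
  obtain ⟨S₀, hS₀⟩ := hS₀
  obtain ⟨M, hM, hMn⟩ := exists_rss_le_mul (β := β) hS₀
  obtain ⟨K, hK, hBF⟩ := exists_bayesFactor_le (hM₀T.trans hTj.1) hM₀T
  -- Each summand has bounded mean. Together they control ‖ε‖² and RSS_T - RSS_j from above and both
  -- residual sums of squares from below.
  set h : (n : ℕ) → (Fin n → ℝ) → ℝ≥0∞ := fun n y =>
    ENNReal.ofReal (n : ℝ)⁻¹ * ENNReal.ofReal (sqNorm (y - design (X n) T *ᵥ β))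
    + ENNReal.ofReal n * (ENNReal.ofReal (rss (design (X n) T) y))⁻¹
    + ENNReal.ofReal n * (ENNReal.ofReal (rss (design (X n) j) y))⁻¹
    + ENNReal.ofReal (rss (design (X n) T) y - rss (design (X n) j) y) with hh
  have hm2 : ∀ n, Measurable fun y : Fin n → ℝ =>
      ENNReal.ofReal n * (ENNReal.ofReal (rss (design (X n) T) y))⁻¹ := fun n =>
    (measurable_ofReal_rss _).inv.const_mul _
  have hm3 : ∀ n, Measurable fun y : Fin n → ℝ =>
      ENNReal.ofReal n * (ENNReal.ofReal (rss (design (X n) j) y))⁻¹ := fun n =>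
    (measurable_ofReal_rss _).inv.const_mul _
  have hm4 : ∀ n, Measurable fun y : Fin n → ℝ =>
      ENNReal.ofReal (rss (design (X n) T) y - rss (design (X n) j) y) := fun n =>
    ((continuous_rss _).sub (continuous_rss _)).measurable.ennreal_ofReal
  refine tendstoInProb_zero_of_lintegral_le (h := h)
    (C₀ := v + 2 / v + 2 / v + 2 * (v * j.card)) (fun n =>
      ((((measurable_ofReal_sqNorm_sub _).const_mul _).add (hm2 n)).add (hm3 n)).add (hm4 n))
    (by positivity) ?_ ?_
  · filter_upwards [hrank, eventually_ge_atTop (512 + 4 * j.card + 4 * T.card)] with n hj hn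
    have hT := linearIndependent_design_of_subset hTj.1 hj
    have hn0 : (0 : ℝ) < n := by
      have : 0 < n := by omega
      exact_mod_cast this
    simp only [hh]
    rw [lintegral_add_right _ (hm4 n), lintegral_add_right _ (hm3 n),
      lintegral_add_right _ (hm2 n), lintegral_const_mul' _ _ ENNReal.ofReal_ne_top,
      lintegral_dataLaw_sqNorm, ← ENNReal.ofReal_mul (by positivity),
      ENNReal.ofReal_add (by positivity) (by positivity),
      ENNReal.ofReal_add (by positivity) (by positivity),
      ENNReal.ofReal_add (by positivity) (by positivity)]
    gcongr
    · exact le_of_eq (by field_simp)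
    · exact lintegral_dataLaw_inv_rss hv hT subset_rfl (by omega)
    · exact lintegral_dataLaw_inv_rss hv hj hTj.1 (by omega)
    · exact lintegral_dataLaw_rss_sub_le hv hj hTj.1
  · intro C hC
    -- The factor 2C + 2M bounds RSS_0/n: RSS_0 is at most 2‖ε‖² plus twice the RSS_0 of the true
    -- mean.
    refine ⟨fun n => K * (n : ℝ) ^ (-(1 / 2) : ℝ) * Real.exp (C ^ 2 / 2) *
      Real.exp (256 * ((2 * C + 2 * M) * C)), ?_, ?_⟩
    · have h1 : Tendsto (fun n : ℕ => (n : ℝ) ^ (-(1 / 2) : ℝ)) atTop (𝓝 0) :=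
        (tendsto_rpow_neg_atTop one_half_pos).comp tendsto_natCast_atTop_atTop
      simpa using ((h1.const_mul K).mul_const (Real.exp (C ^ 2 / 2))).mul_const
        (Real.exp (256 * ((2 * C + 2 * M) * C)))
    · filter_upwards [hrank, hMn, eventually_ge_atTop (512 + 4 * j.card + 4 * T.card)]
        with n hj hMn hn y hy
      have hT := linearIndependent_design_of_subset hTj.1 hj
      have hn1 : (1 : ℝ) ≤ n := by
        have : 1 ≤ n := by omega
        exact_mod_cast this
      have hn0 : (0 : ℝ) < n := by linarith
      have h123 := le_self_add.trans hy
      have h12 := le_self_add.trans h123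
      have g1 := le_mul_of_ofReal_inv_mul_le hn0 hC (le_self_add.trans h12)
      obtain ⟨p2, g2⟩ := pos_and_le_mul_of_ofReal_mul_inv_le hn0 hC (rss_nonneg hT y)
        (le_add_self.trans h12)
      obtain ⟨p3, g3⟩ := pos_and_le_mul_of_ofReal_mul_inv_le hn0 hC (rss_nonneg hj y)
        (le_add_self.trans h123)
      have g4 := (ENNReal.ofReal_le_ofReal_iff hC.le).1 (le_add_self.trans hy)
      refine (hBF n hn (X n) hj hT c hc y p3 p2).trans (ENNReal.ofReal_le_ofReal ?_)
      have hM₀n : (M₀.card : ℝ) ≤ n := by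
        have := Finset.card_le_card hM₀T
        have : M₀.card ≤ n := by omega
        exact_mod_cast this
      refine nested_bound hK hn1 hC (by positivity) ?_ (Nat.cast_nonneg _) hM₀n p2 p3 g4 g3 g2 ?_
      · exact_mod_cast Finset.card_lt_card hTj
      · have := rss_add_le (linearIndependent_design_of_subset hM₀T hT) (design (X n) T *ᵥ β) y
        nlinarith

/-- The cross term is absorbed by -2x ≤ θ + x²/θ with θ = nb/8; of the signal 3nb/4, one eighth of
nb pays for θ and another for the constants, leaving nb/2. -/
theorem rss_lower_bound {C b n RT₀ x D e R : ℝ} (hb : 0 < b) (hn : 0 < n)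
    (hR : R = RT₀ + 2 * x + e - D) (hD : D ≤ C) (hx : x ^ 2 ≤ C * n)
    (hRT₀ : 3 / 4 * b < n⁻¹ * RT₀) (hlarge : 8 * C / b + C ≤ n * b / 8) :
    e + n * b / 2 ≤ R := by
  have h1 : 3 / 4 * b * n < RT₀ := by
    rw [inv_mul_eq_div, lt_div_iff₀ hn] at hRT₀; exact hRT₀
  have h2 : -(2 * x) ≤ n * b / 8 + 8 * C / b := by
    have hθ : 0 < n * b / 8 := by positivity
    have h3 : -(2 * x) ≤ n * b / 8 + x ^ 2 / (n * b / 8) := by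
      rw [← sub_nonneg]
      have : n * b / 8 + x ^ 2 / (n * b / 8) - -(2 * x) = (n * b / 8 + x) ^ 2 / (n * b / 8) := by
        field_simp; ring
      rw [this]; positivity
    have h4 : x ^ 2 / (n * b / 8) ≤ 8 * C / b := by
      rw [div_le_div_iff₀ hθ hb]; nlinarith
    linarith
  linarith

theorem tendstoInProb_bayesFactor_of_not_nested (hM₀T : M₀ ⊆ T) (hM₀j : M₀ ⊆ j)
    (hrankj : ∀ᶠ n in atTop, LinearIndependent ℝ (design (X n) j).col)
    (hrankT : ∀ᶠ n in atTop, LinearIndependent ℝ (design (X n) T).col)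
    (hc : ∀ γ, 0 < c γ) (hv : 0 < v)
    (hS₀ : ∃ S₀ : Matrix T T ℝ, Tendsto (fun n => gapMatrix (X n) T M₀) atTop (𝓝 S₀))
    {S : Matrix T T ℝ} (hS : Tendsto (fun n => gapMatrix (X n) T j) atTop (𝓝 S))
    (hSβ : 0 < β ⬝ᵥ (S *ᵥ β)) :
    TendstoInProb (fun n => dataLaw (X n) T β v) (fun n => bayesFactor c (X n) M₀ j T) 0 := by
  have hv' : (0 : ℝ) < v := hv
  obtain ⟨S₀, hS₀⟩ := hS₀
  obtain ⟨M, hM, hMn⟩ := exists_rss_le_mul (β := β) hS₀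
  obtain ⟨N, hN, hNn⟩ := exists_rss_le_mul (β := β) hS
  obtain ⟨K, hK, hBF⟩ := exists_bayesFactor_le hM₀j hM₀T
  set b := β ⬝ᵥ (S *ᵥ β) with hb
  -- The last two summands control the projected noise and the cross term of `rss_expand`; the
  -- variance of the latter is of order n because the gap matrix converges.
  set h : (n : ℕ) → (Fin n → ℝ) → ℝ≥0∞ := fun n y =>
    ENNReal.ofReal (n : ℝ)⁻¹ * ENNReal.ofReal (sqNorm (y - design (X n) T *ᵥ β))
    + ENNReal.ofReal n * (ENNReal.ofReal (rss (design (X n) T) y))⁻¹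
    + ENNReal.ofReal (sqNorm (hatMatrix (design (X n) j) *ᵥ (y - design (X n) T *ᵥ β)))
    + ENNReal.ofReal (n : ℝ)⁻¹ * ENNReal.ofReal
      ((((1 - hatMatrix (design (X n) j)) *ᵥ (design (X n) T *ᵥ β)) ⬝ᵥ
        (y - design (X n) T *ᵥ β)) ^ 2) with hh
  have hm2 : ∀ n, Measurable fun y : Fin n → ℝ =>
      ENNReal.ofReal n * (ENNReal.ofReal (rss (design (X n) T) y))⁻¹ := fun n =>
    (measurable_ofReal_rss _).inv.const_mul _
  have hm4 : ∀ n, Measurable fun y : Fin n → ℝ =>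
      ENNReal.ofReal (n : ℝ)⁻¹ * ENNReal.ofReal
      ((((1 - hatMatrix (design (X n) j)) *ᵥ (design (X n) T *ᵥ β)) ⬝ᵥ
        (y - design (X n) T *ᵥ β)) ^ 2) := fun n =>
    (((continuous_const.dotProduct
      (continuous_id.sub continuous_const)).pow 2).measurable.ennreal_ofReal).const_mul _
  refine tendstoInProb_zero_of_lintegral_le (h := h)
    (C₀ := v + 2 / v + v * j.card + v * N) (fun n =>
      ((((measurable_ofReal_sqNorm_sub _).const_mul _).add (hm2 n)).add
        (measurable_ofReal_sqNorm_mulVec _ _)).add (hm4 n))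
    (by positivity) ?_ ?_
  · filter_upwards [hrankj, hrankT, hNn, eventually_ge_atTop (512 + 4 * j.card + 4 * T.card)]
      with n hj hT hNn hn
    have hn0 : (0 : ℝ) < n := by
      have : 0 < n := by omega
      exact_mod_cast this
    have hi4 : ∫⁻ y, ENNReal.ofReal (n : ℝ)⁻¹ * ENNReal.ofReal
        ((((1 - hatMatrix (design (X n) j)) *ᵥ (design (X n) T *ᵥ β)) ⬝ᵥ
          (y - design (X n) T *ᵥ β)) ^ 2) ∂dataLaw (X n) T β v
        = ENNReal.ofReal (v * ((n : ℝ)⁻¹ * rss (design (X n) j) (design (X n) T *ᵥ β))) := by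
      rw [lintegral_const_mul' _ _ ENNReal.ofReal_ne_top, lintegral_dataLaw_dotProduct_sq,
        ← rss_eq_sqNorm hj, ← ENNReal.ofReal_mul (by positivity), mul_left_comm]
    simp only [hh]
    rw [lintegral_add_right _ (hm4 n), lintegral_add_right _ (measurable_ofReal_sqNorm_mulVec _ _),
      lintegral_add_right _ (hm2 n), hi4, lintegral_const_mul' _ _ ENNReal.ofReal_ne_top,
      lintegral_dataLaw_sqNorm, lintegral_dataLaw_sqNorm_mulVec (isProj_hatMatrix hj),
      trace_hatMatrix hj, Fintype.card_coe, ← ENNReal.ofReal_mul (by positivity),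
      ENNReal.ofReal_add (by positivity) (by positivity),
      ENNReal.ofReal_add (by positivity) (by positivity),
      ENNReal.ofReal_add (by positivity) (by positivity)]
    gcongr
    · exact le_of_eq (by field_simp)
    · exact lintegral_dataLaw_inv_rss hv hT subset_rfl (by omega)
    · rw [inv_mul_le_iff₀ hn0]
      linarith
  · intro C hC
    have hρ0 : 0 < C / (C + b / 2) := by positivity
    have hρ1 : C / (C + b / 2) < 1 := by
      rw [div_lt_one (by positivity)]; linarith
    refine ⟨fun n => K * (n : ℝ) ^ (T.card : ℝ) *
      (C / (C + b / 2)) ^ (((n : ℝ) - M₀.card) / 2) *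
      Real.exp (256 * ((2 * C + 2 * M) * C)), ?_, ?_⟩
    · have h1 := ((tendsto_rpow_mul_rpow_half_zero hρ0 hρ1 T.card M₀.card).const_mul K).mul_const
        (Real.exp (256 * ((2 * C + 2 * M) * C)))
      simpa only [mul_zero, zero_mul, ← mul_assoc] using h1
    · have hlarge : ∀ᶠ n : ℕ in atTop, 8 * C / b + C ≤ n * b / 8 := by
        have : Tendsto (fun n : ℕ => (n : ℝ) * b / 8) atTop atTop :=
          (tendsto_natCast_atTop_atTop.atTop_mul_const hSβ).atTop_div_const (by norm_num)
        exact this.eventually_ge_atTop _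
      have hgap := (tendsto_rss_of_tendsto_gapMatrix (β := β) hS).eventually_const_lt
        (show 3 / 4 * b < b by linarith)
      filter_upwards [hrankj, hrankT, hMn, hlarge, hgap,
        eventually_ge_atTop (512 + 4 * j.card + 4 * T.card)] with n hj hT hMn hlarge hgap hn y hy
      have hn1 : (1 : ℝ) ≤ n := by
        have : 1 ≤ n := by omega
        exact_mod_cast this
      have hn0 : (0 : ℝ) < n := by linarith
      have h123 := le_self_add.trans hy
      have h12 := le_self_add.trans h123
      have g1 := le_mul_of_ofReal_inv_mul_le hn0 hC (le_self_add.trans h12)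
      obtain ⟨p2, g2⟩ := pos_and_le_mul_of_ofReal_mul_inv_le hn0 hC (rss_nonneg hT y)
        (le_add_self.trans h12)
      have g3 := (ENNReal.ofReal_le_ofReal_iff hC.le).1 (le_add_self.trans h123)
      have g4 := le_mul_of_ofReal_inv_mul_le hn0 hC (le_add_self.trans hy)
      have hRj := rss_lower_bound hSβ hn0 (rss_expand hj (design (X n) T *ᵥ β) y) g3 g4 hgap
        hlarge
      have hε := sqNorm_nonneg (y - design (X n) T *ᵥ β)
      have p3 : 0 < rss (design (X n) j) y := by
        have : 0 < (n : ℝ) * b / 2 := by positivity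
        linarith
      refine (hBF n hn (X n) hj hT c hc y p3 p2).trans (ENNReal.ofReal_le_ofReal ?_)
      have hM₀n : (M₀.card : ℝ) ≤ n := by
        have := Finset.card_le_card hM₀T
        have : M₀.card ≤ n := by omega
        exact_mod_cast this
      refine nonnested_bound hK hn1 hC (by positivity) hSβ (Nat.cast_nonneg _)
        (Nat.cast_nonneg _) hM₀n p2 (rss_le_sqNorm_sub hT y β) g1 hRj g2 ?_
      have := rss_add_le (linearIndependent_design_of_subset hM₀T hT) (design (X n) T *ᵥ β) y
      nlinarith

/-- The mean of n/RSS_T is finite, so RSS_T > 0 almost surely, and then the marginal likelihood is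
positive and finite. -/
theorem tendsto_measure_marginal_degenerate (hM₀T : M₀ ⊆ T)
    (hrank : ∀ᶠ n in atTop, LinearIndependent ℝ (design (X n) T).col)
    (hc : ∀ γ, 0 < c γ) (hv : 0 < v) :
    Tendsto (fun n => dataLaw (X n) T β v
      {y | ¬(marginal c (X n) M₀ T y ≠ 0 ∧ marginal c (X n) M₀ T y ≠ ∞)}) atTop (𝓝 0) := by
  refine tendsto_const_nhds.congr' ?_
  filter_upwards [hrank, eventually_ge_atTop (512 + 4 * T.card)] with n hT hn
  have hn0 : (0 : ℝ) < n := by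
    have : 0 < n := by omega
    exact_mod_cast this
  have h0 : dataLaw (X n) T β v
      {y | ENNReal.ofReal n * (ENNReal.ofReal (rss (design (X n) T) y))⁻¹ = ∞} = 0 :=
    measure_eq_top_of_lintegral_ne_top
      ((measurable_ofReal_rss _).inv.const_mul _).aemeasurable
      (ne_top_of_le_ne_top ENNReal.ofReal_ne_top
        (lintegral_dataLaw_inv_rss hv hT subset_rfl (by omega)))
  refine (measure_mono_null (fun y hy => ?_) h0).symm
  by_contra hne
  refine hy (marginal_ne_zero_ne_top hM₀T hn hT hc ?_)
  refine (rss_nonneg hT y).lt_of_ne fun h => hne ?_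
  simp only [Set.mem_ofPred_eq]
  rw [← h, ENNReal.ofReal_zero, ENNReal.inv_zero,
    ENNReal.mul_top (ENNReal.ofReal_pos.2 hn0).ne']

theorem posteriorProb_eq {n : ℕ} {X : Matrix (Fin n) (Fin p) ℝ} {w : Finset (Fin p) → ℝ}
    {𝓜 : Finset (Finset (Fin p))} (hT : T ∈ 𝓜) (hw : 0 < w T) {y : Fin n → ℝ}
    (h0 : marginal c X M₀ T y ≠ 0) (htop : marginal c X M₀ T y ≠ ∞) :
    posteriorProb c w X M₀ 𝓜 T y
      = (1 + ∑ γ ∈ 𝓜.erase T, ENNReal.ofReal (w γ) / ENNReal.ofReal (w T)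
          * bayesFactor c X M₀ γ T y)⁻¹ := by
  have hwT : ENNReal.ofReal (w T) ≠ 0 := (ENNReal.ofReal_pos.2 hw).ne'
  set D := ENNReal.ofReal (w T) * marginal c X M₀ T y with hD
  have hD0 : D ≠ 0 := mul_ne_zero hwT h0
  have hDtop : D ≠ ∞ := ENNReal.mul_ne_top ENNReal.ofReal_ne_top htop
  have hsum : ∑ γ ∈ 𝓜, ENNReal.ofReal (w γ) * marginal c X M₀ γ y
      = D * (1 + ∑ γ ∈ 𝓜.erase T, ENNReal.ofReal (w γ) / ENNReal.ofReal (w T)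
          * bayesFactor c X M₀ γ T y) := by
    rw [← Finset.add_sum_erase _ _ hT, mul_add, mul_one, Finset.mul_sum]
    congr 1
    refine Finset.sum_congr rfl fun γ _ => ?_
    rw [hD, bayesFactor, mul_mul_mul_comm, ENNReal.mul_div_cancel hwT ENNReal.ofReal_ne_top,
      ENNReal.mul_div_cancel h0 htop]
  rw [posteriorProb, hsum, ← hD, div_eq_mul_inv, ENNReal.mul_inv (Or.inl hD0) (Or.inl hDtop),
    ← mul_assoc, ENNReal.mul_inv_cancel hD0 hDtop, one_mul]

/-- The posterior probability is a continuous function Φ of the Bayes factors with Φ(0) = 1. A box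
around 0 inside the preimage of U and a union bound over the competing models conclude. -/
theorem tendstoInProb_posteriorProb {w : Finset (Fin p) → ℝ} {𝓜 : Finset (Finset (Fin p))}
    (hT : T ∈ 𝓜) (hM₀T : M₀ ⊆ T) (hw : 0 < w T)
    (hrank : ∀ᶠ n in atTop, LinearIndependent ℝ (design (X n) T).col)
    (hc : ∀ γ, 0 < c γ) (hv : 0 < v)
    (h : ∀ γ ∈ 𝓜, γ ≠ T →
      TendstoInProb (fun n => dataLaw (X n) T β v) (fun n => bayesFactor c (X n) M₀ γ T) 0) :
    TendstoInProb (fun n => dataLaw (X n) T β v)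
      (fun n => posteriorProb c w (X n) M₀ 𝓜 T) 1 := by
  intro U hU
  have ha : ∀ γ, ENNReal.ofReal (w γ) / ENNReal.ofReal (w T) ≠ ∞ := fun γ =>
    ENNReal.div_ne_top ENNReal.ofReal_ne_top (ENNReal.ofReal_pos.2 hw).ne'
  set Φ : (Finset (Fin p) → ℝ≥0∞) → ℝ≥0∞ := fun x =>
    (1 + ∑ γ ∈ 𝓜.erase T, ENNReal.ofReal (w γ) / ENNReal.ofReal (w T) * x γ)⁻¹ with hΦ
  have hcont : Continuous Φ := by
    have hsum : Continuous fun x : Finset (Fin p) → ℝ≥0∞ =>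
        1 + ∑ γ ∈ 𝓜.erase T, ENNReal.ofReal (w γ) / ENNReal.ofReal (w T) * x γ :=
      continuous_const.add (continuous_finsetSum _ fun γ _ =>
        (ENNReal.continuous_const_mul (ha γ)).comp (continuous_apply γ))
    exact continuous_inv.comp hsum
  have hΦ0 : Φ 0 = 1 := by simp [hΦ]
  have hpre : Φ ⁻¹' U ∈ 𝓝 (0 : Finset (Fin p) → ℝ≥0∞) :=
    hcont.continuousAt.preimage_mem_nhds (by rwa [hΦ0])
  rw [nhds_pi, Filter.mem_pi'] at hpre
  obtain ⟨I, t, ht, hIt⟩ := hpre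
  have hbound : ∀ n, dataLaw (X n) T β v {y | posteriorProb c w (X n) M₀ 𝓜 T y ∉ U}
      ≤ dataLaw (X n) T β v
          {y | ¬(marginal c (X n) M₀ T y ≠ 0 ∧ marginal c (X n) M₀ T y ≠ ∞)}
        + ∑ γ ∈ 𝓜.erase T, dataLaw (X n) T β v {y | bayesFactor c (X n) M₀ γ T y ∉ t γ} := by
    intro n
    refine le_trans (measure_mono (t := {y | ¬(marginal c (X n) M₀ T y ≠ 0 ∧
      marginal c (X n) M₀ T y ≠ ∞)} ∪
        ⋃ γ ∈ 𝓜.erase T, {y | bayesFactor c (X n) M₀ γ T y ∉ t γ}) ?_)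
      ((measure_union_le _ _).trans (by gcongr; exact measure_biUnion_finset_le _ _))
    intro y hy
    by_contra hcon
    simp only [Set.mem_union, Set.mem_iUnion, not_or, not_exists, Set.mem_ofPred_eq,
      not_not] at hcon
    obtain ⟨⟨h0, htop⟩, hBF⟩ := hcon
    refine hy ?_
    rw [posteriorProb_eq hT hw h0 htop]
    -- Coordinates that Φ ignores are set to 0, so that the box constraint holds for them as well.
    have hmem : (fun γ => if γ ∈ 𝓜.erase T then bayesFactor c (X n) M₀ γ T y else 0)
        ∈ Φ ⁻¹' U := by
      refine hIt fun γ _ => ?_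
      simp only
      split_ifs with hγ
      · exact hBF γ hγ
      · exact mem_of_mem_nhds (ht γ)
    have heq : Φ (fun γ => if γ ∈ 𝓜.erase T then bayesFactor c (X n) M₀ γ T y else 0)
        = (1 + ∑ γ ∈ 𝓜.erase T, ENNReal.ofReal (w γ) / ENNReal.ofReal (w T)
          * bayesFactor c (X n) M₀ γ T y)⁻¹ := by
      simp only [hΦ]
      congr 2
      exact Finset.sum_congr rfl fun γ hγ => by rw [if_pos hγ]
    rw [← heq]
    exact hmem
  have hlim := (tendsto_measure_marginal_degenerate (β := β) hM₀T hrank hc hv).add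
    (tendsto_finsetSum (𝓜.erase T) fun γ hγ =>
      h γ (Finset.mem_of_mem_erase hγ) (Finset.ne_of_mem_erase hγ) (t γ) (ht γ))
  rw [Finset.sum_const_zero, add_zero] at hlim
  exact tendsto_of_tendsto_of_tendsto_of_le_of_le tendsto_const_nhds hlim (fun _ => zero_le)
    hbound

theorem tendstoInProb_bayesFactor (hM₀T : M₀ ⊆ T) (hM₀j : M₀ ⊆ j) (hjT : j ≠ T)
    (hrankj : ∀ᶠ n in atTop, LinearIndependent ℝ (design (X n) j).col)
    (hrankT : ∀ᶠ n in atTop, LinearIndependent ℝ (design (X n) T).col)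
    (hc : ∀ γ, 0 < c γ) (hv : 0 < v)
    (hS₀ : ∃ S₀ : Matrix T T ℝ, Tendsto (fun n => gapMatrix (X n) T M₀) atTop (𝓝 S₀))
    (hj : LimitCondition X T β j) :
    TendstoInProb (fun n => dataLaw (X n) T β v) (fun n => bayesFactor c (X n) M₀ j T) 0 := by
  obtain ⟨S, hS, hpsd, hSβ⟩ := hj
  by_cases hTj : T ⊆ j
  · exact tendstoInProb_bayesFactor_of_nested hM₀T (hTj.ssubset_of_ne hjT.symm) hrankj hc hv hS₀
  · refine tendstoInProb_bayesFactor_of_not_nested hM₀T hM₀j hrankj hrankT hc hv hS₀ hS ?_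
    have h0 := hpsd.dotProduct_mulVec_nonneg β
    -- For a positive semi-definite S, a vanishing quadratic form at β forces Sβ = 0.
    have hne : star β ⬝ᵥ (S *ᵥ β) ≠ 0 := fun h => hSβ hTj (hpsd.dotProduct_mulVec_zero_iff β |>.1 h)
    simpa using lt_of_le_of_ne h0 hne.symm

end Consistency

end JPEP

end

theorem lemma1 {p : ℕ} (X : (n : ℕ) → Matrix (Fin n) (Fin p) ℝ)
    (M₀ : Finset (Fin p)) (𝓜 : Finset (Finset (Fin p))) (hM₀ : ∀ γ ∈ 𝓜, M₀ ⊆ γ)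
    (hrank : ∀ γ ∈ 𝓜, ∀ᶠ n in atTop, LinearIndependent ℝ (JPEP.design (X n) γ).col)
    (c : Finset (Fin p) → ℝ) (hc : ∀ γ, 0 < c γ)
    (w : Finset (Fin p) → ℝ) (hw : ∀ γ ∈ 𝓜, 0 < w γ)
    (T : Finset (Fin p)) (hT : T ∈ 𝓜) (β : T → ℝ) (v : ℝ≥0) (hv : 0 < v)
    (hS₀ : ∃ S₀ : Matrix T T ℝ,
      Tendsto (fun n => JPEP.gapMatrix (X n) T M₀) atTop (𝓝 S₀)) :
    (∀ j ∈ 𝓜, j ≠ T → JPEP.LimitCondition X T β j →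
      JPEP.TendstoInProb (fun n => JPEP.dataLaw (X n) T β v)
        (fun n => JPEP.bayesFactor c (X n) M₀ j T) 0) ∧
    ((∀ j ∈ 𝓜, j ≠ T → JPEP.LimitCondition X T β j) →
      JPEP.TendstoInProb (fun n => JPEP.dataLaw (X n) T β v)
        (fun n => JPEP.posteriorProb c w (X n) M₀ 𝓜 T) 1) := by
  have h₁ : ∀ j ∈ 𝓜, j ≠ T → JPEP.LimitCondition X T β j →
      JPEP.TendstoInProb (fun n => JPEP.dataLaw (X n) T β v)
        (fun n => JPEP.bayesFactor c (X n) M₀ j T) 0 := fun j hj hjT hlim =>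
    JPEP.tendstoInProb_bayesFactor (hM₀ T hT) (hM₀ j hj) hjT (hrank j hj) (hrank T hT) hc hv hS₀
      hlim
  exact ⟨h₁, fun hlim => JPEP.tendstoInProb_posteriorProb hT (hM₀ T hT) (hw T hT) (hrank T hT) hc hv
    fun j hj hjT => h₁ j hj hjT (hlim j hj hjT)⟩
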